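/- Consider the control system $\dot x(t)=f(x(t),w(t))+G(x(t))u(t)$ with state in $\mathbb R^{n_x}$, controls $u(t)\in U\subseteq\mathbb R^{n_u}$ and disturbances $w(t)\in W\subseteq\mathbb R^{n_w}$. Assume that $U$ and $W$ are nonempty, compact and convex, that $U$ has non-empty interior, that $f$ is jointly continuous and locally Lipschitz in $x$ (every $(x_0,w_0)$ has a neighbourhood on which $f$ is Lipschitz in $x$ with one constant), and that $G$ is continuously differentiable. For a nonempty compact set $Z$ let $V[Z](c)=\max_{z\in Z}c^{\mathsf T}z$ be its support function. Let $Y(t)\subset\mathbb R^{n_x}$, $t\in[t_1,t_2]$, be nonempty compact convex sets such that, for every $c\in\mathbb R^{n_x}$, the function $t\mapsto V[Y(t)](c)$ is Lipschitz on $[t_1,t_2]$ and, for a.e. $t\in[t_1,t_2]$, $$\dot V[Y(t)](c)\ \ge\ \min_{\nu\in U}V[\Gamma(\nu,c,Y(t))](c),\qquad \Gamma(\nu,c,Z)=\{f(\xi,\omega)+G(\xi)\nu \mid \xi\in Z,\ c^{\mathsf T}\xi=V[Z](c),\ \omega\in W\}.$$ Assume in addition that $U$ and all $Y(t)$ have smooth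 boundary (near each boundary point the set is $\{g\le 0\}$ with $g$ smooth and $\nabla g\neq0$ at that point) with positive curvature everywhere: the differential of the Gauss map $\mathcal G_Z:\partial Z\to\mathcal S^{n-1}$, which maps a boundary point to its outward unit normal, is positive definite on every tangent space of $\partial Z$. Then: 1. For every $t\in[t_1,t_2]$, $\mathcal G_{Y(t)}:\partial Y(t)\to\mathcal S^{n_x-1}$ is bijective, and for every unit vector $c$ the set $\operatorname{argmax}_{\xi\in Y(t)}c^{\mathsf T}\xi$ consists of the single point $\mathcal G_{Y(t)}^{-1}(c)$. 2. For every $t\in[t_1,t_2]$ and every unit vector $c$, the set $\operatorname{argmin}_{\nu\in U}c^{\mathsf T}G(\mathcal G_{Y(t)}^{-1}(c))\nu$ is nonempty, and it is a singleton if $G(\mathcal G_{Y(t)}^{-1}(c))^{\mathsf T}c\ne0$. 3. Consider the jointly Borel measurable feedback laws $\mu:[t_1,t_2]\times\mathbb R^{n_x}\to U$ such that $$\mu(t,\xi)=\mu_t^*(\mathcal G_{Y(t)}(\xi))\quad\text{for } t\in[t_1,t_2],\ \xi\in\partial Y(t),\qquad \mu^*_t(c)\in\operatorname{argmin}_{\nu\in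 U}c^{\mathsf T}G(\mathcal G_{Y(t)}^{-1}(c))\nu\quad\text{for all unit vectors }c,$$ and which are continued outside the tube so that, for some constant $L$, $\|\mu(t,\xi)-\mu(t,p)\|\le L\|\xi-p\|$ for all $t\in[t_1,t_2]$ and $\xi\notin Y(t)$, with $p$ the point of $Y(t)$ nearest to $\xi$ (for instance, constantly along outward normals); the values in the interior of $Y(t)$ are arbitrary elements of $U$. Such feedback laws exist, and each of them keeps the trajectories in the tube: for $t_1\le s\le s'\le t_2$, every integrable $w:[s,s']\to W$ and every absolutely continuous $x$ with $\dot x(t)=f(x(t),w(t))+G(x(t))\mu(t,x(t))$ for a.e. $t\in[s,s']$, if $x(s)\in Y(s)$ then $x(s')\in Y(s')$. -/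

import Mathlib

open Set Filter Topology MeasureTheory
open scoped ContDiff InnerProductSpace

noncomputable section

namespace RobustTube

/-- Euclidean space of column vectors; `⟪c, z⟫_ℝ` is the product of the row `c` with `z`. -/
abbrev E (n : ℕ) : Type := EuclideanSpace ℝ (Fin n)

/-! ### Compact convex sets, support functions, Gauss maps -/

/-- A (nonempty) compact convex set. -/
structure IsCompactConvex {n : ℕ} (Z : Set (E n)) : Prop where
  compact : IsCompact Z
  convex : Convex ℝ Z
  nonempty : Z.Nonempty

/-- The support function of `Z` (a maximum when `Z` is nonempty and compact). -/
def support {n : ℕ} (Z : Set (E n)) (c : E n) : ℝ :=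
  sSup ((fun z => ⟪c, z⟫_ℝ) '' Z)

/-- The set of maximizers over `Z` of the linear form `c`. -/
def argmaxSet {n : ℕ} (Z : Set (E n)) (c : E n) : Set (E n) :=
  {ξ | ξ ∈ Z ∧ ∀ ζ ∈ Z, ⟪c, ζ⟫_ℝ ≤ ⟪c, ξ⟫_ℝ}

/-- `g` is a smooth defining function of `Z` near `z`: near `z`, the set `Z` is `{g ≤ 0}`,
and the gradient of `g` at `z` does not vanish. -/
def IsDefiningFunctionAt {n : ℕ} (Z : Set (E n)) (z : E n) (g : E n → ℝ) : Prop :=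
  ∃ N : Set (E n), IsOpen N ∧ z ∈ N ∧ ContDiffOn ℝ ∞ g N ∧ gradient g z ≠ 0 ∧
    ∀ y ∈ N, (y ∈ Z ↔ g y ≤ 0)

/-- `Z` is a smooth set: its boundary is a smooth hypersurface, with `Z` on one side of it. -/
def IsSmoothSet {n : ℕ} (Z : Set (E n)) : Prop :=
  ∀ z ∈ frontier Z, ∃ g, IsDefiningFunctionAt Z z g

/-- Any two defining functions have the same normalized gradient at a boundary point. -/
theorem normalized_gradient_eq {n : ℕ} {Z : Set (E n)} {z : E n} {g h : E n → ℝ}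
    (hz : z ∈ frontier Z) (hg : IsDefiningFunctionAt Z z g) (hh : IsDefiningFunctionAt Z z h) :
    ‖gradient g z‖⁻¹ • gradient g z = ‖gradient h z‖⁻¹ • gradient h z := by
  obtain ⟨N, hN, hzN, hgs, hg0, hgZ⟩ := hg
  obtain ⟨M, hM, hzM, hhs, hh0, hhZ⟩ := hh
  -- a defining function vanishes at `z`
  have key : ∀ (k : E n → ℝ) (O : Set (E n)), IsOpen O → z ∈ O → ContinuousAt k z →
      (∀ y ∈ O, (y ∈ Z ↔ k y ≤ 0)) → k z = 0 := by
    intro k O hO hzO hk hkZ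
    rcases lt_trichotomy (k z) 0 with hlt | heq | hgt
    · exfalso
      have hmem : Z ∈ 𝓝 z := by
        filter_upwards [hk.eventually (gt_mem_nhds hlt), hO.mem_nhds hzO] with y hy hyO
        exact (hkZ y hyO).2 (le_of_lt hy)
      exact hz.2 (mem_interior_iff_mem_nhds.2 hmem)
    · exact heq
    · exfalso
      have hmem : Zᶜ ∈ 𝓝 z := by
        filter_upwards [hk.eventually (lt_mem_nhds hgt), hO.mem_nhds hzO] with y hy hyO
        exact fun hyZ => absurd ((hkZ y hyO).1 hyZ) (not_le.2 hy)
      obtain ⟨y, hy1, hy2⟩ := mem_closure_iff_nhds.1 hz.1 _ hmem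
      exact hy1 hy2
  have hgd : DifferentiableAt ℝ g z :=
    (hgs.contDiffAt (hN.mem_nhds hzN)).differentiableAt (by simp)
  have hhd : DifferentiableAt ℝ h z :=
    (hhs.contDiffAt (hM.mem_nhds hzM)).differentiableAt (by simp)
  have hgz : g z = 0 := key g N hN hzN hgd.continuousAt hgZ
  have hhz : h z = 0 := key h M hM hzM hhd.continuousAt hhZ
  set a := ‖gradient g z‖⁻¹ • gradient g z with ha
  set b := ‖gradient h z‖⁻¹ • gradient h z with hb
  have hgp : 0 < ‖gradient g z‖ := norm_pos_iff.2 hg0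
  have hhp : 0 < ‖gradient h z‖ := norm_pos_iff.2 hh0
  have ha1 : ‖a‖ = 1 := by
    rw [ha, norm_smul, norm_inv, norm_norm, inv_mul_cancel₀ hgp.ne']
  have hb1 : ‖b‖ = 1 := by
    rw [hb, norm_smul, norm_inv, norm_norm, inv_mul_cancel₀ hhp.ne']
  by_contra hab
  have hlt : ⟪a, b⟫_ℝ < 1 := inner_lt_one_iff_real_of_norm_eq_one ha1 hb1 |>.2 hab
  -- along `b - a` the function `g` decreases and the function `h` increases
  have slope : ∀ k : E n → ℝ, DifferentiableAt ℝ k z →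
      HasDerivAt (fun s : ℝ => k (z + s • (b - a))) ⟪gradient k z, b - a⟫_ℝ 0 := by
    intro k hk
    have h1 : HasFDerivAt k (InnerProductSpace.toDual ℝ (E n) (gradient k z))
        (z + (0 : ℝ) • (b - a)) := by
      simpa using hk.hasGradientAt.hasFDerivAt
    have h2 : HasDerivAt (fun s : ℝ => z + s • (b - a)) (b - a) 0 := by
      simpa using ((hasDerivAt_id (0 : ℝ)).smul_const (b - a)).const_add z
    have h3 := h1.comp_hasDerivAt (0 : ℝ) h2
    rw [InnerProductSpace.toDual_apply_apply] at h3
    exact h3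
  have hga : gradient g z = ‖gradient g z‖ • a := by
    rw [ha, smul_smul, mul_inv_cancel₀ hgp.ne', one_smul]
  have hhb : gradient h z = ‖gradient h z‖ • b := by
    rw [hb, smul_smul, mul_inv_cancel₀ hhp.ne', one_smul]
  have hsg : ⟪gradient g z, b - a⟫_ℝ < 0 := by
    rw [hga, real_inner_smul_left, inner_sub_right, real_inner_self_eq_norm_sq, ha1]
    nlinarith
  have hsh : 0 < ⟪gradient h z, b - a⟫_ℝ := by
    rw [hhb, real_inner_smul_left, inner_sub_right, real_inner_self_eq_norm_sq, hb1,
      real_inner_comm]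
    nlinarith
  have hpath : ContinuousAt (fun s : ℝ => z + s • (b - a)) 0 := by fun_prop
  have e1 : ∀ᶠ s in 𝓝[>] (0 : ℝ), z + s • (b - a) ∈ N ∩ M :=
    (hpath.eventually (by
      simpa using (hN.inter hM).mem_nhds ⟨hzN, hzM⟩)).filter_mono nhdsWithin_le_nhds
  have lim : ∀ k : E n → ℝ, DifferentiableAt ℝ k z → k z = 0 →
      Tendsto (fun s : ℝ => s⁻¹ * k (z + s • (b - a))) (𝓝[>] 0) (𝓝 ⟪gradient k z, b - a⟫_ℝ) := by
    intro k hk hkz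
    have h1 := (slope k hk).tendsto_slope_zero_right
    simpa [hkz] using h1
  have e2 := (lim g hgd hgz).eventually (gt_mem_nhds hsg)
  have e3 := (lim h hhd hhz).eventually (lt_mem_nhds hsh)
  obtain ⟨s, ⟨hs1, hs2⟩, hs3, hs4, hs5⟩ :=
    (e1.and (e2.and (e3.and self_mem_nhdsWithin))).exists
  have hs0 : (0 : ℝ) < s := hs5
  have hgs' : g (z + s • (b - a)) < 0 := by
    by_contra hc
    exact absurd hs3 (not_lt.2 (mul_nonneg (inv_nonneg.2 hs0.le) (not_lt.1 hc)))
  have hhs' : 0 < h (z + s • (b - a)) := by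
    by_contra hc
    exact absurd hs4 (not_lt.2
      (mul_nonpos_of_nonneg_of_nonpos (inv_nonneg.2 hs0.le) (not_lt.1 hc)))
  exact absurd ((hhZ _ hs2).1 ((hgZ _ hs1).2 hgs'.le)) (not_le.2 hhs')

open Classical in
/-- The Gauss map of a smooth set `Z`: at a boundary point `z`, the normalized gradient of a
defining function (which one is irrelevant, see `gaussMap_eq`). Only its values on the boundary
of `Z` are meaningful. -/
def gaussMap {n : ℕ} (Z : Set (E n)) (z : E n) : E n :=
  if h : ∃ g, IsDefiningFunctionAt Z z g then
    ‖gradient h.choose z‖⁻¹ • gradient h.choose z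
  else 0

/-- The Gauss map can be computed from any defining function. -/
theorem gaussMap_eq {n : ℕ} {Z : Set (E n)} {z : E n} {g : E n → ℝ}
    (hz : z ∈ frontier Z) (hg : IsDefiningFunctionAt Z z g) :
    gaussMap Z z = ‖gradient g z‖⁻¹ • gradient g z := by
  have h : ∃ g, IsDefiningFunctionAt Z z g := ⟨g, hg⟩
  rw [gaussMap, dif_pos h]
  exact normalized_gradient_eq hz h.choose_spec hg

/-- The inverse of the Gauss map, from the unit sphere to the boundary of `Z`. -/
def invGaussMap {n : ℕ} (Z : Set (E n)) (c : E n) : E n :=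
  Function.invFunOn (gaussMap Z) (frontier Z) c

/-- `Z` has positive curvature at its boundary point `ζ`: the differential of the Gauss map along
the boundary is positive definite on the tangent space at `ζ`. (The restriction of `D` to the
tangent space is determined by the Gauss map.) -/
def HasPositiveCurvatureAt {n : ℕ} (Z : Set (E n)) (ζ : E n) : Prop :=
  ∃ D : E n →L[ℝ] E n, HasFDerivWithinAt (gaussMap Z) D (frontier Z) ζ ∧
    ∀ w : E n, ⟪gaussMap Z ζ, w⟫_ℝ = 0 → w ≠ 0 → 0 < ⟪w, D w⟫_ℝ

/-- A smooth set whose boundary has positive curvature everywhere. -/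
def IsSmoothPositivelyCurved {n : ℕ} (Z : Set (E n)) : Prop :=
  IsSmoothSet Z ∧ ∀ ζ ∈ frontier Z, HasPositiveCurvatureAt Z ζ

/-! ### The control system `x' = f(x, w) + G(x) u` -/

/-- `f` is locally Lipschitz in its first argument: near every point `(x₀, w₀)`, with a common
constant. -/
def LocallyLipschitzInState {nx nw : ℕ} (f : E nx → E nw → E nx) : Prop :=
  ∀ (x₀ : E nx) (w₀ : E nw), ∃ K : NNReal, ∃ A ∈ 𝓝 x₀, ∃ B ∈ 𝓝 w₀,
    ∀ b ∈ B, LipschitzOnWith K (fun x => f x b) A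

/-- The possible velocities `f(ξ, b) + G(ξ) ν`, with `ξ` in the face of `Z` in direction `c` and
`b` in `W`. -/
def velocitySet {nx nu nw : ℕ} (f : E nx → E nw → E nx) (G : E nx → E nu →L[ℝ] E nx)
    (W : Set (E nw)) (ν : E nu) (c : E nx) (Z : Set (E nx)) : Set (E nx) :=
  {v | ∃ ξ ∈ Z, ∃ b ∈ W, ⟪c, ξ⟫_ℝ = support Z c ∧ v = f ξ b + G ξ ν}

/-- The right-hand side of the min-max differential inequality: the minimum over `ν ∈ U` of the
support function of the velocity set. -/
def minmaxRate {nx nu nw : ℕ} (f : E nx → E nw → E nx) (G : E nx → E nu →L[ℝ] E nx)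
    (U : Set (E nu)) (W : Set (E nw)) (c : E nx) (Z : Set (E nx)) : ℝ :=
  sInf ((fun ν => support (velocitySet f G W ν c Z) c) '' U)

/-- The min-max differential inequality for the tube `Y` on `[t₁, t₂]`. The support function of
the cross-sections is Lipschitz in time, hence differentiable almost everywhere. -/
structure SatisfiesMinmaxDI {nx nu nw : ℕ} (f : E nx → E nw → E nx)
    (G : E nx → E nu →L[ℝ] E nx) (U : Set (E nu)) (W : Set (E nw))
    (t₁ t₂ : ℝ) (Y : ℝ → Set (E nx)) : Prop where
  compactConvex : ∀ t ∈ Icc t₁ t₂, IsCompactConvex (Y t)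
  lipschitz : ∀ c : E nx, ∃ K : NNReal, LipschitzOnWith K (fun t => support (Y t) c) (Icc t₁ t₂)
  inequality : ∀ c : E nx, ∀ᵐ t ∂(volume.restrict (Icc t₁ t₂)),
    minmaxRate f G U W c (Y t) ≤ deriv (fun τ => support (Y τ) c) t

/-- A disturbance on `[s, s']`: an integrable function with values in `W`. -/
def IsDisturbance {nw : ℕ} (W : Set (E nw)) (s s' : ℝ) (w : ℝ → E nw) : Prop :=
  IntegrableOn w (Icc s s') ∧ ∀ t ∈ Icc s s', w t ∈ W

/-- `x` is a (Carathéodory) solution on `[s, s']` of the system controlled by the feedback `μ`,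
with disturbance `w`. -/
def IsClosedLoopSolution {nx nu nw : ℕ} (f : E nx → E nw → E nx)
    (G : E nx → E nu →L[ℝ] E nx) (μ : ℝ → E nx → E nu) (w : ℝ → E nw)
    (s s' : ℝ) (x : ℝ → E nx) : Prop :=
  AbsolutelyContinuousOnInterval x s s' ∧
    ∀ᵐ t ∂(volume.restrict (Icc s s')),
      HasDerivAt x (f (x t) (w t) + G (x t) (μ t (x t))) t

/-- A feedback control law on `[t₁, t₂]` with values in `U`. Joint Borel measurability gives
integrability in time along every trajectory, as `U` is bounded. -/
structure IsFeedbackLaw {nx nu : ℕ} (U : Set (E nu)) (t₁ t₂ : ℝ) (μ : ℝ → E nx → E nu) :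
    Prop where
  mem : ∀ t ∈ Icc t₁ t₂, ∀ ξ, μ t ξ ∈ U
  measurable : Measurable (fun p : Icc t₁ t₂ × E nx => μ p.1 p.2)

/-- The feedback `μ` makes the tube `Y` robustly forward invariant on `[t₁, t₂]`: every solution
that is in the tube at time `s` is in the tube at every later time `s'` up to which it exists,
whatever the disturbance. -/
def KeepsInTube {nx nu nw : ℕ} (f : E nx → E nw → E nx) (G : E nx → E nu →L[ℝ] E nx)
    (W : Set (E nw)) (t₁ t₂ : ℝ) (Y : ℝ → Set (E nx)) (μ : ℝ → E nx → E nu) : Prop :=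
  ∀ s s' : ℝ, t₁ ≤ s → s ≤ s' → s' ≤ t₂ → ∀ (w : ℝ → E nw) (x : ℝ → E nx),
    IsDisturbance W s s' w → IsClosedLoopSolution f G μ w s s' x → x s ∈ Y s → x s' ∈ Y s'

/-! ### The explicit feedback -/

/-- The set of minimizers over `ν ∈ U` of `cᵀ G(𝒢⁻¹(c)) ν`, with `𝒢` the Gauss map of `Z`. -/
def argminSet {nx nu : ℕ} (G : E nx → E nu →L[ℝ] E nx) (U : Set (E nu)) (Z : Set (E nx))
    (c : E nx) : Set (E nu) :=
  {ν | ν ∈ U ∧ ∀ ν' ∈ U,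
    ⟪c, G (invGaussMap Z c) ν⟫_ℝ ≤ ⟪c, G (invGaussMap Z c) ν'⟫_ℝ}

/-- On the boundary of the tube, `μ(t, ξ) = μ*_t(𝒢_{Y(t)}(ξ))`, where `μ*_t(c)` is a minimizer of
`cᵀ G(𝒢⁻¹_{Y(t)}(c)) ν` over `ν ∈ U`. -/
def FollowsExplicitLaw {nx nu : ℕ} (G : E nx → E nu →L[ℝ] E nx) (U : Set (E nu))
    (t₁ t₂ : ℝ) (Y : ℝ → Set (E nx)) (μ : ℝ → E nx → E nu) : Prop :=
  ∃ μs : ℝ → E nx → E nu,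
    (∀ t ∈ Icc t₁ t₂, ∀ c ∈ Metric.sphere (0 : E nx) 1, μs t c ∈ argminSet G U (Y t) c) ∧
    ∀ t ∈ Icc t₁ t₂, ∀ ξ ∈ frontier (Y t), μ t ξ = μs t (gaussMap (Y t) ξ)

/-- Outside the tube, the feedback differs from its value at the nearest point of the tube by at
most a constant times the distance to the tube. It holds if `μ` is constant along the outward
normals of the cross-sections, or Lipschitz in the state outside them. -/
def LipschitzOutwards {nx nu : ℕ} (t₁ t₂ : ℝ) (Y : ℝ → Set (E nx)) (μ : ℝ → E nx → E nu) :
    Prop :=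
  ∃ L : ℝ, ∀ t ∈ Icc t₁ t₂, ∀ ξ ∉ Y t, ∀ p ∈ Y t,
    dist ξ p = Metric.infDist ξ (Y t) → ‖μ t ξ - μ t p‖ ≤ L * dist ξ p

end RobustTube

end

namespace RobustTube

open scoped NNReal

/-! ### Smooth convex sets with positive curvature -/

section Geometry

variable {n : ℕ} {Z : Set (E n)} {z c : E n} {g : E n → ℝ}

/-! Geometry. Compactness gives a maximizer of every linear form, smoothness makes the unit normal
at a boundary point unique (`gaussMap_eq_of_mem_argmaxSet`), and positive curvature reduces each
face to a point: along a segment in a face the Gauss map is constant, so its differential would kill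
a tangent vector (`argmaxSet_subsingleton`). Hence the Gauss map is bijective. The same face lemma
applied to `U` gives uniqueness of the minimizing control, which maximizes the form given by `-Gᵀc`.

Existence. A point outside the interior of `Y t` has a unique foot `p` and a unique outward unit
normal `c`. Both depend continuously on time and point, because uniqueness and compactness turn
closed graphs into continuity (`continuousOn_of_isClosed_graph`). Minimizing `⟪c, G p ν⟫` over `U`
gives a Borel feedback that is constant along outward normals.

Invariance. Let `a` be the last time in the tube of a trajectory that ends outside, and let `d` be
its distance to the tube. The difficulty is that the differential inequality holds for almost every
time with a null set depending on the direction, whereas the normal `c t` moves. So for `t₀ < t` the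
direction is frozen at `e = c t`: the function `⟪e, x⟫ - V[Y](e)` equals `d t` at time `t`, is at
most `d t₀` at time `t₀`, and is absolutely continuous (`SatisfiesMinmaxDI.inner_sub_support_le`).
At an intermediate time `σ` its derivative is at most `Λ (d σ + ‖p σ - 𝒢⁻¹(e)‖ + ‖e - c σ‖)`, by
comparing the feedback at `p σ` with the best control for `e` (`inner_velocity_sub_minmaxRate_le`).
The last two terms vanish as `t` and `σ` tend to `t₀`. The right slopes of `d` are thus at most `Λ
max d`, which forces `d = 0` at the end of a short interval after `a` (`eq_zero_of_slope_le`), a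
contradiction. -/

theorem IsDefiningFunctionAt.hasDerivAt_line (hg : IsDefiningFunctionAt Z z g) (d : E n) :
    HasDerivAt (fun s : ℝ => g (z + s • d)) ⟪gradient g z, d⟫_ℝ 0 := by
  obtain ⟨N, hN, hzN, hgs, -, -⟩ := hg
  have hk : DifferentiableAt ℝ g z :=
    (hgs.contDiffAt (hN.mem_nhds hzN)).differentiableAt (by simp)
  have h1 : HasFDerivAt g (InnerProductSpace.toDual ℝ (E n) (gradient g z))
      (z + (0 : ℝ) • d) := by
    simpa using hk.hasGradientAt.hasFDerivAt
  have h2 : HasDerivAt (fun s : ℝ => z + s • d) d 0 := by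
    simpa using ((hasDerivAt_id (0 : ℝ)).smul_const d).const_add z
  have h3 := h1.comp_hasDerivAt (0 : ℝ) h2
  rw [InnerProductSpace.toDual_apply_apply] at h3
  exact h3

theorem IsDefiningFunctionAt.apply_eq_zero (hz : z ∈ frontier Z)
    (hg : IsDefiningFunctionAt Z z g) : g z = 0 := by
  obtain ⟨N, hN, hzN, hgs, -, hgZ⟩ := hg
  have hk : ContinuousAt g z :=
    ((hgs.contDiffAt (hN.mem_nhds hzN)).differentiableAt (by simp)).continuousAt
  rcases lt_trichotomy (g z) 0 with hlt | heq | hgt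
  · refine absurd (mem_interior_iff_mem_nhds.2 ?_) hz.2
    filter_upwards [hk.eventually (gt_mem_nhds hlt), hN.mem_nhds hzN] with y hy hyO
    exact (hgZ y hyO).2 (le_of_lt hy)
  · exact heq
  · exfalso
    have hmem : Zᶜ ∈ 𝓝 z := by
      filter_upwards [hk.eventually (lt_mem_nhds hgt), hN.mem_nhds hzN] with y hy hyO
      exact fun hyZ => absurd ((hgZ y hyO).1 hyZ) (not_le.2 hy)
    obtain ⟨y, hy1, hy2⟩ := mem_closure_iff_nhds.1 hz.1 _ hmem
    exact hy1 hy2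

theorem tendsto_add_smul (z d : E n) :
    Tendsto (fun s : ℝ => z + s • d) (𝓝[>] 0) (𝓝 z) := by
  have : Continuous (fun s : ℝ => z + s • d) := by fun_prop
  simpa using (this.tendsto 0).mono_left nhdsWithin_le_nhds

/-- Directions of negative slope of a defining function point into the set. -/
theorem IsDefiningFunctionAt.eventually_mem (hz : z ∈ frontier Z)
    (hg : IsDefiningFunctionAt Z z g) {d : E n} (hd : ⟪gradient g z, d⟫_ℝ < 0) :
    ∀ᶠ s in 𝓝[>] (0 : ℝ), z + s • d ∈ Z := by
  have h1 := (hg.hasDerivAt_line d).tendsto_slope_zero_right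
  have h0 := hg.apply_eq_zero hz
  obtain ⟨N, hN, hzN, -, -, hgZ⟩ := hg
  filter_upwards [h1.eventually (gt_mem_nhds hd), self_mem_nhdsWithin,
    (tendsto_add_smul z d).eventually (hN.mem_nhds hzN)] with s hs hs0 hsN
  refine (hgZ _ hsN).2 (not_lt.1 fun hc => ?_)
  have hs0 : (0 : ℝ) < s := hs0
  simp only [zero_add, zero_smul, add_zero, h0, sub_zero, smul_eq_mul] at hs
  exact absurd hs (not_lt.2 (mul_nonneg (inv_nonneg.2 hs0.le) hc.le))

/-- Directions of positive slope of a defining function point out of the set. -/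
theorem IsDefiningFunctionAt.eventually_notMem (hz : z ∈ frontier Z)
    (hg : IsDefiningFunctionAt Z z g) {d : E n} (hd : 0 < ⟪gradient g z, d⟫_ℝ) :
    ∀ᶠ s in 𝓝[>] (0 : ℝ), z + s • d ∉ Z := by
  have h1 := (hg.hasDerivAt_line d).tendsto_slope_zero_right
  have h0 := hg.apply_eq_zero hz
  obtain ⟨N, hN, hzN, -, -, hgZ⟩ := hg
  filter_upwards [h1.eventually (lt_mem_nhds hd), self_mem_nhdsWithin,
    (tendsto_add_smul z d).eventually (hN.mem_nhds hzN)] with s hs hs0 hsN hZ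
  have hc := (hgZ _ hsN).1 hZ
  have hs0 : (0 : ℝ) < s := hs0
  simp only [zero_add, zero_smul, add_zero, h0, sub_zero, smul_eq_mul] at hs
  exact absurd hs (not_lt.2 (mul_nonpos_of_nonneg_of_nonpos (inv_nonneg.2 hs0.le) hc))

theorem norm_gaussMap (hZ : IsSmoothSet Z) (hz : z ∈ frontier Z) : ‖gaussMap Z z‖ = 1 := by
  obtain ⟨g, hg⟩ := hZ z hz
  obtain ⟨-, -, -, -, hg0, -⟩ := id hg
  rw [gaussMap_eq hz hg, norm_smul, norm_inv, norm_norm, inv_mul_cancel₀ (norm_ne_zero_iff.2 hg0)]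

/-- The Gauss map takes values in the normal cone. -/
theorem gaussMap_mem_normalCone (hconv : Convex ℝ Z) (hcl : IsClosed Z) (hZ : IsSmoothSet Z)
    (hz : z ∈ frontier Z) : z ∈ argmaxSet Z (gaussMap Z z) := by
  refine ⟨hcl.frontier_subset hz, fun y hy => ?_⟩
  obtain ⟨g, hg⟩ := hZ z hz
  rw [gaussMap_eq hz hg, real_inner_smul_left, real_inner_smul_left]
  refine mul_le_mul_of_nonneg_left (not_lt.1 fun hc => ?_) (by positivity)
  have hd : 0 < ⟪gradient g z, y - z⟫_ℝ := by rw [inner_sub_right]; linarith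
  have h1 : ∀ᶠ s in 𝓝[>] (0 : ℝ), s < 1 :=
    nhdsWithin_le_nhds (gt_mem_nhds one_pos)
  obtain ⟨s, hs, hs1, hs0⟩ :=
    ((hg.eventually_notMem hz hd).and (h1.and self_mem_nhdsWithin)).exists
  exact hs (hconv.add_smul_sub_mem (hcl.frontier_subset hz) hy ⟨le_of_lt hs0, hs1.le⟩)

theorem argmaxSet_subset_frontier (hc : c ≠ 0) : argmaxSet Z c ⊆ frontier Z := by
  intro z hz
  refine ⟨subset_closure hz.1, fun hi => ?_⟩
  have h1 := (tendsto_add_smul z c).eventually (mem_interior_iff_mem_nhds.1 hi)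
  obtain ⟨s, hs, hs0⟩ := (h1.and self_mem_nhdsWithin).exists
  have := hz.2 _ hs
  rw [inner_add_right, real_inner_smul_right] at this
  have h2 : 0 < s * ⟪c, c⟫_ℝ := mul_pos hs0 (real_inner_self_pos.2 hc)
  linarith

/-- A smooth set has only one unit normal vector at a boundary point. -/
theorem gaussMap_eq_of_mem_argmaxSet (hZ : IsSmoothSet Z) (hc : ‖c‖ = 1)
    (hz : z ∈ argmaxSet Z c) : gaussMap Z z = c := by
  have hz' : z ∈ frontier Z := argmaxSet_subset_frontier (norm_ne_zero_iff.1 (by simp [hc])) hz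
  have ha1 := norm_gaussMap hZ hz'
  by_contra hne
  have hlt : ⟪gaussMap Z z, c⟫_ℝ < 1 := inner_lt_one_iff_real_of_norm_eq_one ha1 hc |>.2 hne
  obtain ⟨g, hg⟩ := hZ z hz'
  obtain ⟨-, -, -, -, hg0, -⟩ := id hg
  have hgp : 0 < ‖gradient g z‖ := norm_pos_iff.2 hg0
  have hga : gradient g z = ‖gradient g z‖ • gaussMap Z z := by
    rw [gaussMap_eq hz' hg, smul_smul, mul_inv_cancel₀ hgp.ne', one_smul]
  -- The direction `c - gaussMap Z z` enters `Z` and yet increases the form `c`, against the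
  -- maximality of `z`.
  have hd : ⟪gradient g z, c - gaussMap Z z⟫_ℝ < 0 := by
    rw [hga, real_inner_smul_left, inner_sub_right, real_inner_self_eq_norm_sq, ha1]
    nlinarith
  obtain ⟨s, hs, hs0⟩ := ((hg.eventually_mem hz' hd).and self_mem_nhdsWithin).exists
  have h1 := hz.2 _ hs
  have hs0 : (0 : ℝ) < s := hs0
  rw [inner_add_right, real_inner_smul_right, inner_sub_right, real_inner_self_eq_norm_sq, hc,
    real_inner_comm (gaussMap Z z) c] at h1
  nlinarith

theorem mem_argmaxSet_iff (hconv : Convex ℝ Z) (hcl : IsClosed Z) (hZ : IsSmoothSet Z)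
    (hc : ‖c‖ = 1) : z ∈ argmaxSet Z c ↔ z ∈ frontier Z ∧ gaussMap Z z = c := by
  refine ⟨fun h => ⟨argmaxSet_subset_frontier (norm_ne_zero_iff.1 (by simp [hc])) h,
    gaussMap_eq_of_mem_argmaxSet hZ hc h⟩, ?_⟩
  rintro ⟨h, rfl⟩
  exact gaussMap_mem_normalCone hconv hcl hZ h

theorem argmaxSet_smul {r : ℝ} (hr : 0 < r) : argmaxSet Z (r • c) = argmaxSet Z c := by
  ext z
  simp only [argmaxSet, mem_ofPred_eq, real_inner_smul_left, mul_le_mul_iff_right₀ hr]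

/-- Positive curvature excludes segments in the boundary: faces are points. -/
theorem argmaxSet_subsingleton (hconv : Convex ℝ Z) (hcl : IsClosed Z)
    (hZ : IsSmoothPositivelyCurved Z) (hc : c ≠ 0) : (argmaxSet Z c).Subsingleton := by
  wlog h1 : ‖c‖ = 1 generalizing c
  · have hn : 0 < ‖c‖⁻¹ := inv_pos.2 (norm_pos_iff.2 hc)
    rw [← argmaxSet_smul hn]
    refine this (smul_ne_zero hn.ne' hc) ?_
    rw [norm_smul, norm_inv, norm_norm, inv_mul_cancel₀ (norm_ne_zero_iff.2 hc)]
  intro y hy z hz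
  by_contra hne
  obtain ⟨hyf, hyc⟩ := (mem_argmaxSet_iff hconv hcl hZ.1 h1).1 hy
  obtain ⟨D, hD, hpos⟩ := hZ.2 y hyf
  have hin : ⟪c, z - y⟫_ℝ = 0 := by
    rw [inner_sub_right, sub_eq_zero]
    exact le_antisymm (hy.2 z hz.1) (hz.2 y hy.1)
  have hseg : ∀ s ∈ Icc (0 : ℝ) 1, y + s • (z - y) ∈ argmaxSet Z c := by
    intro s hs
    refine ⟨hconv.add_smul_sub_mem hy.1 hz.1 hs, fun ζ hζ => ?_⟩
    rw [inner_add_right, real_inner_smul_right, hin, mul_zero, add_zero]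
    exact hy.2 ζ hζ
  have hseg' := fun s hs => (mem_argmaxSet_iff hconv hcl hZ.1 h1).1 (hseg s hs)
  have hl : HasDerivWithinAt (fun s : ℝ => y + s • (z - y)) (z - y) (Icc 0 1) 0 := by
    simpa using (((hasDerivAt_id (0 : ℝ)).smul_const (z - y)).const_add y).hasDerivWithinAt
  have hD' : HasFDerivWithinAt (gaussMap Z) D (frontier Z) (y + (0 : ℝ) • (z - y)) := by
    simpa using hD
  -- The one-sided derivative at `y` is computed twice: by the chain rule, and from constancy on the
  -- segment.
  have h2 : HasDerivWithinAt (gaussMap Z ∘ fun s : ℝ => y + s • (z - y)) (D (z - y)) (Icc 0 1) 0 :=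
    hD'.comp_hasDerivWithinAt 0 hl fun s hs => (hseg' s hs).1
  have h3 : HasDerivWithinAt (gaussMap Z ∘ fun s : ℝ => y + s • (z - y)) 0 (Icc 0 1) 0 :=
    (hasDerivWithinAt_const (0 : ℝ) (Icc 0 1) c).congr (fun s hs => (hseg' s hs).2)
      (hseg' 0 (by simp)).2
  have h4 : D (z - y) = 0 :=
    (uniqueDiffOn_Icc one_pos 0 (by simp)).eq_deriv _ h2 h3
  have h5 := hpos (z - y) (by rw [hyc]; exact hin) (sub_ne_zero.2 (Ne.symm hne))
  rw [h4, inner_zero_right] at h5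
  exact lt_irrefl _ h5

theorem IsCompactConvex.argmaxSet_nonempty (h : IsCompactConvex Z) (c : E n) :
    (argmaxSet Z c).Nonempty := by
  obtain ⟨z, hz, hm⟩ := h.compact.exists_isMaxOn h.nonempty
    (f := fun z => ⟪c, z⟫_ℝ) (by fun_prop)
  exact ⟨z, hz, fun ζ hζ => hm hζ⟩

theorem bijOn_gaussMap (h : IsCompactConvex Z) (hZ : IsSmoothPositivelyCurved Z) :
    BijOn (gaussMap Z) (frontier Z) (Metric.sphere 0 1) := by
  have hcl := h.compact.isClosed
  refine ⟨fun z hz => by simpa using norm_gaussMap hZ.1 hz, fun y hy z hz hyz => ?_,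
    fun c hc => ?_⟩
  · have h1 := norm_gaussMap hZ.1 hy
    refine argmaxSet_subsingleton h.convex hcl hZ (norm_ne_zero_iff.1 (by simp [h1]))
      (gaussMap_mem_normalCone h.convex hcl hZ.1 hy) ?_
    rw [hyz]
    exact gaussMap_mem_normalCone h.convex hcl hZ.1 hz
  · obtain ⟨z, hz⟩ := h.argmaxSet_nonempty c
    exact ⟨z, (mem_argmaxSet_iff h.convex hcl hZ.1 (by simpa using hc)).1 hz⟩

theorem argmaxSet_eq_invGaussMap (h : IsCompactConvex Z) (hZ : IsSmoothPositivelyCurved Z)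
    (hc : ‖c‖ = 1) : argmaxSet Z c = {invGaussMap Z c} := by
  have hb := bijOn_gaussMap h hZ
  have hs := hb.surjOn (show c ∈ Metric.sphere 0 1 by simpa using hc)
  have hm : invGaussMap Z c ∈ argmaxSet Z c :=
    (mem_argmaxSet_iff h.convex h.compact.isClosed hZ.1 hc).2
      ⟨Function.invFunOn_mem hs, Function.invFunOn_eq hs⟩
  exact Subset.antisymm (fun z hz => argmaxSet_subsingleton h.convex h.compact.isClosed hZ
    (norm_ne_zero_iff.1 (by simp [hc])) hz hm) (singleton_subset_iff.2 hm)

theorem invGaussMap_mem (h : IsCompactConvex Z) (hZ : IsSmoothPositivelyCurved Z)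
    (hc : ‖c‖ = 1) : invGaussMap Z c ∈ argmaxSet Z c := by
  rw [argmaxSet_eq_invGaussMap h hZ hc]; rfl

theorem eq_invGaussMap (h : IsCompactConvex Z) (hZ : IsSmoothPositivelyCurved Z)
    (hc : ‖c‖ = 1) (hz : z ∈ argmaxSet Z c) : z = invGaussMap Z c := by
  rwa [argmaxSet_eq_invGaussMap h hZ hc] at hz

/-! ### Support functions -/

theorem IsCompactConvex.inner_le_support (h : IsCompactConvex Z) (c : E n) (hz : z ∈ Z) :
    ⟪c, z⟫_ℝ ≤ support Z c :=
  le_csSup (h.compact.image (f := fun z => ⟪c, z⟫_ℝ) (by fun_prop)).bddAbove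
    (mem_image_of_mem (fun z => ⟪c, z⟫_ℝ) hz)

theorem IsCompactConvex.support_le (h : IsCompactConvex Z) {r : ℝ}
    (hr : ∀ z ∈ Z, ⟪c, z⟫_ℝ ≤ r) : support Z c ≤ r :=
  csSup_le (h.nonempty.image _) (forall_mem_image.2 hr)

theorem IsCompactConvex.mem_argmaxSet (h : IsCompactConvex Z) :
    z ∈ argmaxSet Z c ↔ z ∈ Z ∧ ⟪c, z⟫_ℝ = support Z c :=
  and_congr_right fun hz => ⟨fun hm => le_antisymm (h.inner_le_support c hz) (h.support_le hm),
    fun he _ hζ => he ▸ h.inner_le_support c hζ⟩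

theorem IsCompactConvex.mem_iff_inner_le (h : IsCompactConvex Z) :
    z ∈ Z ↔ ∀ c : E n, ⟪c, z⟫_ℝ ≤ support Z c := by
  refine ⟨fun hz c => h.inner_le_support c hz, fun hz => by_contra fun hn => ?_⟩
  obtain ⟨l, u, hl, hu⟩ := geometric_hahn_banach_closed_point h.convex h.compact.isClosed hn
  set c := (InnerProductSpace.toDual ℝ (E n)).symm l with hc
  have hin : ∀ y, ⟪c, y⟫_ℝ = l y := fun y => InnerProductSpace.toDual_symm_apply
  have h1 : support Z c ≤ u := h.support_le fun y hy => by rw [hin]; exact (hl y hy).le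
  have h2 := hz c
  rw [hin] at h2
  linarith

theorem IsCompactConvex.abs_support_sub_le (h : IsCompactConvex Z) {R : ℝ}
    (hR : ∀ z ∈ Z, ‖z‖ ≤ R) (c c' : E n) : |support Z c - support Z c'| ≤ R * ‖c - c'‖ := by
  have key : ∀ c c' : E n, support Z c ≤ support Z c' + R * ‖c - c'‖ := by
    intro c c'
    refine h.support_le fun z hz => ?_
    have h1 := h.inner_le_support c' hz
    have h2 := (real_inner_le_norm (c - c') z).trans
      (mul_le_mul_of_nonneg_left (hR z hz) (norm_nonneg _))
    rw [inner_sub_left] at h2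
    linarith
  have h1 := key c c'
  have h2 := key c' c
  rw [norm_sub_rev] at h2
  rw [abs_le]
  constructor <;> linarith

end Geometry

/-! ### Continuity from closed graphs -/

/-- Values stay in a compact set and every cluster point lies in the closed relation, so uniqueness
leaves a single cluster point. -/
theorem continuousOn_of_isClosed_graph {X X' : Type*} [TopologicalSpace X] [TopologicalSpace X']
    {R : Set (X × X')} (hR : IsClosed R) {K : Set X'} (hK : IsCompact K) {F : X → X'} {S : Set X}
    (hFK : ∀ x ∈ S, F x ∈ K) (hFR : ∀ x ∈ S, (x, F x) ∈ R)
    (huniq : ∀ x ∈ S, ∀ y, (x, y) ∈ R → y = F x) : ContinuousOn F S := by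
  intro x hx
  refine hK.tendsto_nhds_of_unique_mapClusterPt
    (eventually_mem_nhdsWithin.mono fun y hy => hFK y hy) fun y _ hy => huniq x hx y ?_
  obtain ⟨u, hu, hy⟩ := mapClusterPt_iff_ultrafilter.1 hy
  have hx' : Tendsto id (u : Filter X) (𝓝 x) := hu.trans nhdsWithin_le_nhds
  exact hR.mem_of_tendsto (hx'.prodMk_nhds hy)
    ((eventually_mem_nhdsWithin.filter_mono hu).mono fun z hz => hFR z hz)

theorem isClosed_fst_image_of_isCompact {X X' : Type*} [TopologicalSpace X] [TopologicalSpace X']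
    {R : Set (X × X')} (hR : IsClosed R) {K : Set X'} (hK : IsCompact K)
    (hRK : ∀ q ∈ R, q.2 ∈ K) : IsClosed (Prod.fst '' R) := by
  rw [isClosed_iff_ultrafilter]
  intro x u hu hR'
  have : Nonempty X' := (u.nonempty_of_mem hR').elim fun _ ⟨q, _, _⟩ => ⟨q.2⟩
  choose! y hy using fun z (hz : z ∈ Prod.fst '' R) => (show ∃ y, (z, y) ∈ R by
    obtain ⟨q, hq, rfl⟩ := hz
    exact ⟨q.2, hq⟩)
  have hyK : y ⁻¹' K ∈ u := Filter.mem_of_superset hR' fun z hz => hRK _ (hy z hz)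
  obtain ⟨y₀, -, hy₀⟩ := hK.ultrafilter_le_nhds (u.map y) (le_principal_iff.2 hyK)
  have hu' : Tendsto id (u : Filter X) (𝓝 x) := hu
  have hyt : Tendsto y (u : Filter X) (𝓝 y₀) := hy₀
  exact ⟨(x, y₀), hR.mem_of_tendsto (hu'.prodMk_nhds hyt)
    (Filter.mem_of_superset hR' fun z hz => hy z hz), rfl⟩

/-! ### Feet and outward normals of points outside a convex set -/

/-- `p` is a point of `Z` at which `c` is a unit outward normal, and `ξ` is on the ray from `p` in
direction `c`. -/
structure IsFoot {n : ℕ} (Z : Set (E n)) (ξ p c : E n) : Prop where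
  norm_eq : ‖c‖ = 1
  mem_argmaxSet : p ∈ argmaxSet Z c
  sub_eq : ξ - p = ‖ξ - p‖ • c

section Foot

variable {n : ℕ} {Z : Set (E n)} {ξ p c q d : E n}

theorem IsFoot.inner_sub_nonpos (h : IsFoot Z ξ p c) (hq : q ∈ Z) : ⟪ξ - p, q - p⟫_ℝ ≤ 0 := by
  rw [h.sub_eq, real_inner_smul_left, inner_sub_right]
  exact mul_nonpos_of_nonneg_of_nonpos (norm_nonneg _) (sub_nonpos.2 (h.mem_argmaxSet.2 q hq))

/-- The obtuse-angle inequalities at the two feet add up to `‖q - p‖² ≤ 0`. -/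
theorem IsFoot.point_unique (h : IsFoot Z ξ p c) (h' : IsFoot Z ξ q d) : p = q := by
  have h1 := h.inner_sub_nonpos h'.mem_argmaxSet.1
  have h2 := h'.inner_sub_nonpos h.mem_argmaxSet.1
  have h3 : ⟪q - p, q - p⟫_ℝ = ⟪ξ - p, q - p⟫_ℝ + ⟪ξ - q, p - q⟫_ℝ := by
    rw [← neg_sub q p, inner_neg_right, ← sub_eq_add_neg, ← inner_sub_left]
    congr 1; abel
  rw [real_inner_self_eq_norm_sq] at h3
  have h4 : ‖q - p‖ = 0 := pow_eq_zero_iff two_ne_zero |>.1 (le_antisymm (by linarith) (sq_nonneg _))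
  exact (sub_eq_zero.1 (norm_eq_zero.1 h4)).symm

theorem IsFoot.normal_eq (hZ : IsSmoothSet Z) (h : IsFoot Z ξ p c) : c = gaussMap Z p :=
  (gaussMap_eq_of_mem_argmaxSet hZ h.norm_eq h.mem_argmaxSet).symm

theorem IsFoot.normal_unique (hZ : IsSmoothSet Z) (h : IsFoot Z ξ p c) (h' : IsFoot Z ξ q d) :
    c = d := by
  rw [h.normal_eq hZ, h'.normal_eq hZ, h.point_unique h']

theorem IsFoot.mem_frontier (h : IsFoot Z ξ p c) : p ∈ frontier Z :=
  argmaxSet_subset_frontier (norm_ne_zero_iff.1 (by simp [h.norm_eq])) h.mem_argmaxSet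

theorem IsFoot.inner_sub (h : IsFoot Z ξ p c) : ⟪c, ξ - p⟫_ℝ = ‖ξ - p‖ := by
  rw [h.sub_eq, real_inner_smul_right, real_inner_self_eq_norm_sq, h.norm_eq, ← h.sub_eq]
  simp

theorem IsFoot.foot (h : IsFoot Z ξ p c) : IsFoot Z p p c :=
  ⟨h.norm_eq, h.mem_argmaxSet, by simp⟩

theorem isFoot_of_mem_frontier (hcc : IsCompactConvex Z) (hZ : IsSmoothSet Z)
    (h : p ∈ frontier Z) : IsFoot Z p p (gaussMap Z p) :=
  ⟨norm_gaussMap hZ h, gaussMap_mem_normalCone hcc.convex hcc.compact.isClosed hZ h, by simp⟩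

theorem isFoot_of_dist_eq_infDist (hcc : IsCompactConvex Z) (hξ : ξ ∉ Z) (hp : p ∈ Z)
    (hd : dist ξ p = Metric.infDist ξ Z) : IsFoot Z ξ p (‖ξ - p‖⁻¹ • (ξ - p)) := by
  have hne : ‖ξ - p‖ ≠ 0 := norm_ne_zero_iff.2 (sub_ne_zero.2 fun h => hξ (h ▸ hp))
  have hmin : ‖ξ - p‖ = ⨅ w : Z, ‖ξ - w‖ := by
    rw [← dist_eq_norm, hd, Metric.infDist_eq_iInf]
    simp only [dist_eq_norm]
  have hn := (norm_eq_iInf_iff_real_inner_le_zero hcc.convex hp).1 hmin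
  refine ⟨by rw [norm_smul, norm_inv, norm_norm, inv_mul_cancel₀ hne], ⟨hp, fun ζ hζ => ?_⟩,
    by rw [smul_smul, mul_inv_cancel₀ hne, one_smul]⟩
  have := hn ζ hζ
  rw [inner_sub_right, sub_nonpos] at this
  rw [real_inner_smul_left, real_inner_smul_left]
  exact mul_le_mul_of_nonneg_left this (by positivity)

theorem exists_isFoot_of_notMem (hcc : IsCompactConvex Z) (hξ : ξ ∉ Z) :
    ∃ p c, IsFoot Z ξ p c := by
  obtain ⟨p, hp, hd⟩ := hcc.compact.exists_infDist_eq_dist hcc.nonempty ξ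
  exact ⟨p, _, isFoot_of_dist_eq_infDist hcc hξ hp hd.symm⟩

open Classical in
/-- The foot of a point and the outward normal there; zero if there is none, that is, for interior
points. -/
noncomputable def footPair {n : ℕ} (Z : Set (E n)) (ξ : E n) : E n × E n :=
  if h : ∃ q : E n × E n, IsFoot Z ξ q.1 q.2 then h.choose else 0

theorem IsFoot.footPair_eq (hZ : IsSmoothSet Z) (h : IsFoot Z ξ p c) : footPair Z ξ = (p, c) := by
  have hex : ∃ q : E n × E n, IsFoot Z ξ q.1 q.2 := ⟨(p, c), h⟩
  rw [footPair, dif_pos hex]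
  exact Prod.ext (hex.choose_spec.point_unique h) (hex.choose_spec.normal_unique hZ h)

end Foot

/-! ### Continuous families of smooth convex sets -/

section FootDomain

variable {n : ℕ} {α : Type*} {Y : α → Set (E n)} {R : ℝ}

/-- The points of a family of sets that have a foot: those outside the interiors. -/
def footDomain (Y : α → Set (E n)) : Set (α × E n) :=
  Prod.fst '' {r : (α × E n) × (E n × E n) | IsFoot (Y r.1.1) r.1.2 r.2.1 r.2.2}

theorem mem_footDomain {q : α × E n} :
    q ∈ footDomain Y ↔ ∃ p c, IsFoot (Y q.1) q.2 p c := by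
  constructor
  · rintro ⟨r, hr, rfl⟩
    exact ⟨_, _, hr⟩
  · rintro ⟨p, c, h⟩
    exact ⟨(q, (p, c)), h, rfl⟩

theorem isFoot_footPair (hs : ∀ a, IsSmoothPositivelyCurved (Y a)) {q : α × E n}
    (hq : q ∈ footDomain Y) :
    IsFoot (Y q.1) q.2 (footPair (Y q.1) q.2).1 (footPair (Y q.1) q.2).2 := by
  obtain ⟨p, c, h⟩ := mem_footDomain.1 hq
  rwa [h.footPair_eq (hs _).1]

theorem isFoot_mem_compact (hR : ∀ a, ∀ z ∈ Y a, ‖z‖ ≤ R) {r : (α × E n) × (E n × E n)}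
    (h : IsFoot (Y r.1.1) r.1.2 r.2.1 r.2.2) :
    r.2 ∈ Metric.closedBall (0 : E n) R ×ˢ Metric.closedBall (0 : E n) 1 :=
  ⟨by simpa using hR _ _ h.mem_argmaxSet.1, by simp [h.norm_eq]⟩

theorem footPair_eq_zero {q : α × E n} (hq : q ∉ footDomain Y) : footPair (Y q.1) q.2 = 0 :=
  dif_neg fun ⟨r, hr⟩ => hq (mem_footDomain.2 ⟨r.1, r.2, hr⟩)

end FootDomain

section Family

variable {n : ℕ} {α : Type*} [TopologicalSpace α] {Y : α → Set (E n)} {R : ℝ}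

/-- By Hahn–Banach, membership is a family of weak inequalities between functions continuous in both
the parameter and the point. -/
theorem isClosed_graph_family (hY : ∀ a, IsCompactConvex (Y a))
    (hV : Continuous fun q : α × E n => support (Y q.1) q.2) :
    IsClosed {q : α × E n | q.2 ∈ Y q.1} := by
  have : {q : α × E n | q.2 ∈ Y q.1} =
      ⋂ c : E n, {q : α × E n | ⟪c, q.2⟫_ℝ ≤ support (Y q.1) c} := by
    ext q
    simp only [mem_iInter]
    exact (hY q.1).mem_iff_inner_le
  rw [this]
  refine isClosed_iInter fun c => isClosed_le (by fun_prop) ?_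
  exact hV.comp (continuous_fst.prodMk continuous_const)

theorem isClosed_argmaxSet_family (hY : ∀ a, IsCompactConvex (Y a))
    (hV : Continuous fun q : α × E n => support (Y q.1) q.2) :
    IsClosed {q : (α × E n) × E n | q.2 ∈ argmaxSet (Y q.1.1) q.1.2} := by
  simp only [(hY _).mem_argmaxSet]
  refine IsClosed.and ?_ ?_
  · exact (isClosed_graph_family hY hV).preimage
      (f := fun q : (α × E n) × E n => (q.1.1, q.2)) (by fun_prop)
  · exact isClosed_eq (by fun_prop) (hV.comp continuous_fst)

theorem continuousOn_invGaussMap (hY : ∀ a, IsCompactConvex (Y a))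
    (hs : ∀ a, IsSmoothPositivelyCurved (Y a))
    (hV : Continuous fun q : α × E n => support (Y q.1) q.2) (hR : ∀ a, ∀ z ∈ Y a, ‖z‖ ≤ R) :
    ContinuousOn (fun q : α × E n => invGaussMap (Y q.1) q.2) {q | ‖q.2‖ = 1} :=
  continuousOn_of_isClosed_graph (isClosed_argmaxSet_family hY hV)
    (isCompact_closedBall (0 : E n) R)
    (fun q hq => by simpa using hR q.1 _ (invGaussMap_mem (hY _) (hs _) hq).1)
    (fun q hq => invGaussMap_mem (hY _) (hs _) hq)
    (fun q hq z hz => eq_invGaussMap (hY _) (hs _) hq hz)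

theorem tendsto_invGaussMap (hY : ∀ a, IsCompactConvex (Y a))
    (hs : ∀ a, IsSmoothPositivelyCurved (Y a))
    (hV : Continuous fun q : α × E n => support (Y q.1) q.2) (hR : ∀ a, ∀ z ∈ Y a, ‖z‖ ≤ R)
    {ι : Type*} {l : Filter ι} {φ : ι → α} {ψ : ι → E n} {a : α} {c p : E n}
    (hφ : Tendsto φ l (𝓝 a)) (hψ : Tendsto ψ l (𝓝 c)) (hψ1 : ∀ᶠ i in l, ‖ψ i‖ = 1)
    (hc : ‖c‖ = 1) (hp : p ∈ argmaxSet (Y a) c) :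
    Tendsto (fun i => invGaussMap (Y (φ i)) (ψ i)) l (𝓝 p) := by
  have h1 := continuousOn_invGaussMap hY hs hV hR (a, c) hc
  rw [eq_invGaussMap (hY a) (hs a) hc hp]
  have h2 : Tendsto (fun i => (φ i, ψ i)) l (𝓝[{q : α × E n | ‖q.2‖ = 1}] (a, c)) :=
    tendsto_nhdsWithin_iff.2 ⟨hφ.prodMk_nhds hψ, hψ1⟩
  have h3 := Tendsto.comp h1 h2
  simp only [Function.comp_def] at h3
  exact h3

theorem isClosed_isFoot_family (hY : ∀ a, IsCompactConvex (Y a))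
    (hV : Continuous fun q : α × E n => support (Y q.1) q.2) :
    IsClosed {r : (α × E n) × (E n × E n) | IsFoot (Y r.1.1) r.1.2 r.2.1 r.2.2} := by
  have : {r : (α × E n) × (E n × E n) | IsFoot (Y r.1.1) r.1.2 r.2.1 r.2.2} =
      {r | ‖r.2.2‖ = 1} ∩ ({r | r.2.1 ∈ argmaxSet (Y r.1.1) r.2.2} ∩
        {r | r.1.2 - r.2.1 = ‖r.1.2 - r.2.1‖ • r.2.2}) := by
    ext r
    exact ⟨fun h => ⟨h.1, h.2, h.3⟩, fun h => ⟨h.1, h.2.1, h.2.2⟩⟩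
  rw [this]
  refine (isClosed_eq (by fun_prop) (by fun_prop)).inter (IsClosed.inter ?_
    (isClosed_eq (by fun_prop) (by fun_prop)))
  exact (isClosed_argmaxSet_family hY hV).preimage
    (f := fun r : (α × E n) × (E n × E n) => ((r.1.1, r.2.2), r.2.1)) (by fun_prop)

/-- Feet and unit normals stay in a fixed compact set, and projection along a compact factor
preserves closedness. -/
theorem isClosed_footDomain (hY : ∀ a, IsCompactConvex (Y a))
    (hV : Continuous fun q : α × E n => support (Y q.1) q.2) (hR : ∀ a, ∀ z ∈ Y a, ‖z‖ ≤ R) :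
    IsClosed (footDomain Y) :=
  isClosed_fst_image_of_isCompact (isClosed_isFoot_family hY hV)
    ((isCompact_closedBall _ _).prod (isCompact_closedBall _ _))
    fun _ h => isFoot_mem_compact hR h

theorem continuousOn_footPair (hY : ∀ a, IsCompactConvex (Y a))
    (hs : ∀ a, IsSmoothPositivelyCurved (Y a))
    (hV : Continuous fun q : α × E n => support (Y q.1) q.2) (hR : ∀ a, ∀ z ∈ Y a, ‖z‖ ≤ R) :
    ContinuousOn (fun q : α × E n => footPair (Y q.1) q.2) (footDomain Y) :=
  continuousOn_of_isClosed_graph (isClosed_isFoot_family hY hV)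
    ((isCompact_closedBall (0 : E n) R).prod (isCompact_closedBall (0 : E n) 1))
    (fun q hq => isFoot_mem_compact hR (r := (q, _)) (isFoot_footPair hs hq))
    (fun _ hq => isFoot_footPair hs hq)
    (fun _ _ _ hz => (IsFoot.footPair_eq (hs _).1 hz).symm)

theorem measurable_footPair [MeasurableSpace α] [OpensMeasurableSpace (α × E n)]
    (hY : ∀ a, IsCompactConvex (Y a)) (hs : ∀ a, IsSmoothPositivelyCurved (Y a))
    (hV : Continuous fun q : α × E n => support (Y q.1) q.2) (hR : ∀ a, ∀ z ∈ Y a, ‖z‖ ≤ R) :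
    Measurable (fun q : α × E n => footPair (Y q.1) q.2) := by
  classical
  have h := (continuousOn_footPair hY hs hV hR).measurable_piecewise
    (g := fun _ => (0 : E n × E n)) continuousOn_const (isClosed_footDomain hY hV hR).measurableSet
  convert h using 1
  ext1 q
  by_cases hq : q ∈ footDomain Y
  · rw [piecewise_eq_of_mem _ _ _ hq]
  · rw [piecewise_eq_of_notMem _ _ _ hq, footPair_eq_zero hq]

end Family

/-! ### Minimizing controls -/

section Controls

variable {nx nu : ℕ} {U : Set (E nu)} {ν₀ : E nu}

open Classical in
/-- A minimizer over `U` of the linear form `h`, equal to `ν₀` if `h = 0`. -/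
noncomputable def minimizer {nu : ℕ} (U : Set (E nu)) (ν₀ h : E nu) : E nu :=
  if hh : h ≠ 0 ∧ (argmaxSet U (-h)).Nonempty then hh.2.some else ν₀

theorem minimizer_mem (hU : IsCompactConvex U) (hν₀ : ν₀ ∈ U) (h : E nu) :
    minimizer U ν₀ h ∈ argmaxSet U (-h) := by
  by_cases h0 : h = 0
  · subst h0
    simp [minimizer, argmaxSet, hν₀]
  · have hh : h ≠ 0 ∧ (argmaxSet U (-h)).Nonempty := ⟨h0, hU.argmaxSet_nonempty _⟩
    rw [minimizer, dif_pos hh]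
    exact hh.2.some_mem

/-- Minimizers are unique, hence continuous in the form, except at the zero form; a single point
does not affect measurability. -/
theorem measurable_minimizer (hU : IsCompactConvex U) (hs : IsSmoothPositivelyCurved U)
    (hν₀ : ν₀ ∈ U) : Measurable (minimizer U ν₀) := by
  refine measurable_of_continuousOn_compl_singleton 0 ?_
  have hR : IsClosed {q : E nu × E nu | q.2 ∈ argmaxSet U (-q.1)} := by
    refine IsClosed.and (hU.compact.isClosed.preimage continuous_snd) ?_
    simp only [ofPred_forall]
    exact isClosed_iInter fun ζ => isClosed_iInter fun _ =>
      isClosed_le (by fun_prop) (by fun_prop)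
  exact continuousOn_of_isClosed_graph hR hU.compact
    (fun h _ => (minimizer_mem hU hν₀ h).1) (fun h _ => minimizer_mem hU hν₀ h)
    (fun h hh ν hν => argmaxSet_subsingleton hU.convex hU.compact.isClosed hs
      (neg_ne_zero.2 hh) hν (minimizer_mem hU hν₀ h))

/-- Transposing `G` turns the minimization into a face of `U`, to which the results on strictly
curved sets apply. -/
theorem argminSet_eq (G : E nx → E nu →L[ℝ] E nx) (U : Set (E nu)) (Z : Set (E nx)) (c : E nx) :
    argminSet G U Z c = argmaxSet U (-(ContinuousLinearMap.adjoint (G (invGaussMap Z c)) c)) := by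
  ext ν
  simp only [argminSet, argmaxSet, mem_ofPred_eq, inner_neg_left,
    ContinuousLinearMap.adjoint_inner_left, neg_le_neg_iff]

end Controls

/-! ### Absolutely continuous functions -/

theorem _root_.AbsolutelyContinuousOnInterval.lipschitz_comp {X X' : Type*} [PseudoMetricSpace X]
    [PseudoMetricSpace X'] {x : ℝ → X} {a b : ℝ} (hx : AbsolutelyContinuousOnInterval x a b)
    {φ : X → X'} {K : ℝ≥0} (hφ : LipschitzWith K φ) :
    AbsolutelyContinuousOnInterval (fun t => φ (x t)) a b := by
  rw [absolutelyContinuousOnInterval_iff] at hx ⊢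
  intro ε hε
  -- `K + 1` replaces `K` as divisor because `K` may be zero.
  have hK : (0 : ℝ) < K + 1 := by positivity
  obtain ⟨δ, hδ, h⟩ := hx (ε / (K + 1)) (by positivity)
  refine ⟨δ, hδ, fun I hI hlt => ?_⟩
  have h1 := h I hI hlt
  rw [lt_div_iff₀ hK, Finset.sum_mul] at h1
  refine lt_of_le_of_lt (Finset.sum_le_sum fun i _ => ?_) h1
  refine (hφ.dist_le_mul _ _).trans ?_
  nlinarith [dist_nonneg (x := x (I.2 i).1) (y := x (I.2 i).2)]

theorem _root_.AbsolutelyContinuousOnInterval.sub_le_of_deriv_le {h : ℝ → ℝ} {a b C : ℝ}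
    (hab : a ≤ b) (hh : AbsolutelyContinuousOnInterval h a b)
    (hC : ∀ᵐ t ∂(volume.restrict (Icc a b)), deriv h t ≤ C) : h b - h a ≤ C * (b - a) := by
  rw [← hh.integral_deriv_eq_sub]
  refine (intervalIntegral.integral_mono_ae_restrict hab hh.intervalIntegrable_deriv
    intervalIntegrable_const hC).trans ?_
  rw [intervalIntegral.integral_const, smul_eq_mul, mul_comm]

/-! ### Regularity of the support function of a tube -/

section Tube

variable {nx nu nw : ℕ} {f : E nx → E nw → E nx} {G : E nx → E nu →L[ℝ] E nx}
  {U : Set (E nu)} {W : Set (E nw)} {t₁ t₂ : ℝ} {Y : ℝ → Set (E nx)}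

/-- The support functions in the directions `±eᵢ` are bounded in time, and they bound every
coordinate. -/
theorem SatisfiesMinmaxDI.exists_norm_le (hY : SatisfiesMinmaxDI f G U W t₁ t₂ Y) :
    ∃ R : ℝ, 0 ≤ R ∧ ∀ t ∈ Icc t₁ t₂, ∀ z ∈ Y t, ‖z‖ ≤ R := by
  have h1 : ∀ c : E nx, ∃ M : ℝ, 0 ≤ M ∧ ∀ t ∈ Icc t₁ t₂, support (Y t) c ≤ M := by
    intro c
    obtain ⟨K, hK⟩ := hY.lipschitz c
    obtain ⟨M, hM⟩ := (isCompact_Icc.image_of_continuousOn hK.continuousOn).bddAbove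
    exact ⟨max M 0, le_max_right _ _,
      fun t ht => (hM (mem_image_of_mem _ ht)).trans (le_max_left _ _)⟩
  choose M hM0 hM using h1
  let e := EuclideanSpace.basisFun (Fin nx) ℝ
  refine ⟨∑ i, (M (e i) + M (-e i)),
    Finset.sum_nonneg fun i _ => add_nonneg (hM0 _) (hM0 _), fun t ht z hz => ?_⟩
  rw [← e.sum_repr' z]
  refine norm_sum_le_of_le _ fun i _ => ?_
  rw [norm_smul, e.orthonormal.1 i, mul_one, Real.norm_eq_abs, abs_le]
  have h2 := ((hY.compactConvex t ht).inner_le_support (e i) hz).trans (hM _ t ht)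
  have h3 := ((hY.compactConvex t ht).inner_le_support (-e i) hz).trans (hM _ t ht)
  rw [inner_neg_left] at h3
  constructor <;> linarith [hM0 (e i), hM0 (-e i)]

/-- Lipschitz in the direction with a constant independent of time, and continuous in time for each
direction: this gives joint continuity. `projIcc` freezes the tube outside the interval, so that
time ranges over all of `ℝ`. -/
theorem SatisfiesMinmaxDI.continuous_support (hY : SatisfiesMinmaxDI f G U W t₁ t₂ Y)
    (h : t₁ ≤ t₂) :
    Continuous fun q : ℝ × E nx => support (Y (projIcc t₁ t₂ h q.1)) q.2 := by
  obtain ⟨R, hR0, hR⟩ := hY.exists_norm_le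
  refine continuous_prod_of_continuous_lipschitzWith' _ R.toNNReal (fun t => ?_) fun c => ?_
  · refine LipschitzWith.of_dist_le_mul fun c c' => ?_
    rw [Real.dist_eq, dist_eq_norm, Real.coe_toNNReal _ hR0]
    exact (hY.compactConvex _ (projIcc t₁ t₂ h t).2).abs_support_sub_le
      (hR _ (projIcc t₁ t₂ h t).2) c c'
  · obtain ⟨K, hK⟩ := hY.lipschitz c
    exact hK.continuousOn.comp_continuous (continuous_subtype_val.comp continuous_projIcc)
      fun t => (projIcc t₁ t₂ h t).2

/-! ### Existence of the feedback -/

theorem exists_feedbackLaw (hU : IsCompactConvex U) (hG : Continuous G)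
    (hY : SatisfiesMinmaxDI f G U W t₁ t₂ Y) (hUsm : IsSmoothPositivelyCurved U)
    (hYsm : ∀ t ∈ Icc t₁ t₂, IsSmoothPositivelyCurved (Y t)) :
    ∃ μ : ℝ → E nx → E nu, IsFeedbackLaw U t₁ t₂ μ ∧ FollowsExplicitLaw G U t₁ t₂ Y μ ∧
      LipschitzOutwards t₁ t₂ Y μ := by
  obtain ⟨ν₀, hν₀⟩ := hU.nonempty
  -- At interior points `footPair` is zero, so `k` takes the default value `ν₀`.
  let k : E nx × E nx → E nu := fun q =>
    minimizer U ν₀ (ContinuousLinearMap.adjoint (G q.1) q.2)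
  have hfoot : ∀ t ∈ Icc t₁ t₂, ∀ {ξ p c}, IsFoot (Y t) ξ p c →
      k (footPair (Y t) ξ) = k (p, c) := fun t ht ξ p c h => by
    rw [h.footPair_eq (hYsm t ht).1]
  refine ⟨fun t ξ => k (footPair (Y t) ξ), ⟨fun t _ ξ => (minimizer_mem hU hν₀ _).1, ?_⟩,
    ⟨fun t c => k (invGaussMap (Y t) c, c), fun t _ c _ => ?_, fun t ht ξ hξ => ?_⟩,
    ⟨0, fun t ht ξ hξ p hp hd => ?_⟩⟩
  · rcases lt_or_ge t₂ t₁ with h | h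
    · have : IsEmpty (Icc t₁ t₂) := isEmpty_coe_sort.2 (Icc_eq_empty (not_le.2 h))
      exact measurable_of_empty _
    · obtain ⟨R, -, hR⟩ := hY.exists_norm_le
      have hm := measurable_footPair (Y := fun t => Y (projIcc t₁ t₂ h t))
        (fun t => hY.compactConvex _ (projIcc t₁ t₂ h t).2)
        (fun t => hYsm _ (projIcc t₁ t₂ h t).2) (hY.continuous_support h)
        (fun t => hR _ (projIcc t₁ t₂ h t).2)
      have hk : Measurable k := by
        refine (measurable_minimizer hU hUsm hν₀).comp (Continuous.measurable ?_)
        exact (ContinuousLinearMap.adjoint.continuous.comp (hG.comp continuous_fst)).clm_apply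
          continuous_snd
      have h2 : Measurable fun p : Icc t₁ t₂ × E nx => ((p.1 : ℝ), p.2) := by fun_prop
      convert (hk.comp hm).comp h2 using 1
      ext1 p
      simp [projIcc_val]
  · rw [argminSet_eq]
    exact minimizer_mem hU hν₀ _
  · have hfr := isFoot_of_mem_frontier (hY.compactConvex t ht) (hYsm t ht).1 hξ
    beta_reduce
    rw [hfoot t ht hfr, ← eq_invGaussMap (hY.compactConvex t ht) (hYsm t ht) hfr.norm_eq
      hfr.mem_argmaxSet]
  · have hf := isFoot_of_dist_eq_infDist (hY.compactConvex t ht) hξ hp hd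
    beta_reduce
    rw [hfoot t ht hf, hfoot t ht hf.foot, sub_self, norm_zero, zero_mul]

/-! ### Pointwise estimates -/

/-- For every competing `ν'`, the velocity at the same `ξ` and `b` is admissible in the inner
maximum, and `ν` does no worse than `ν'` at `ξ`. -/
theorem le_minmaxRate (hU : IsCompactConvex U) (hW : IsCompactConvex W)
    (hf : Continuous (Function.uncurry f)) (hG : Continuous G) {Z : Set (E nx)}
    (hZ : IsCompactConvex Z) {c ξ : E nx} (hξ : ξ ∈ argmaxSet Z c) {b : E nw} (hb : b ∈ W)
    {ν : E nu} (hν : ∀ ν' ∈ U, ⟪c, G ξ ν⟫_ℝ ≤ ⟪c, G ξ ν'⟫_ℝ) :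
    ⟪c, f ξ b + G ξ ν⟫_ℝ ≤ minmaxRate f G U W c Z := by
  refine le_csInf (hU.nonempty.image _) (forall_mem_image.2 fun ν' hν' => ?_)
  have hbdd : BddAbove ((fun z => ⟪c, z⟫_ℝ) '' velocitySet f G W ν' c Z) := by
    refine ((hZ.compact.prod hW.compact).image
      (f := fun q : E nx × E nw => ⟪c, f q.1 q.2 + G q.1 ν'⟫_ℝ) ?_).bddAbove.mono ?_
    · have h1 : Continuous fun q : E nx × E nw => f q.1 q.2 := hf
      fun_prop
    · rintro _ ⟨_, ⟨ζ, hζ, b', hb', -, rfl⟩, rfl⟩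
      exact ⟨(ζ, b'), ⟨hζ, hb'⟩, rfl⟩
  have hmem : f ξ b + G ξ ν' ∈ velocitySet f G W ν' c Z :=
    ⟨ξ, hξ.1, b, hb, (hZ.mem_argmaxSet.1 hξ).2, rfl⟩
  refine le_trans ?_ (le_csSup hbdd (mem_image_of_mem _ hmem))
  rw [inner_add_right, inner_add_right]
  linarith [hν ν' hν']

/-- A finite subcover of `W` gives one constant and one neighbourhood for all disturbances. -/
theorem LocallyLipschitzInState.exists_lipschitzOnWith (hfL : LocallyLipschitzInState f)
    (hW : IsCompact W) (x₀ : E nx) :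
    ∃ K : ℝ≥0, ∃ A ∈ 𝓝 x₀, ∀ b ∈ W, LipschitzOnWith K (fun x => f x b) A := by
  refine hW.induction_on (p := fun S => ∃ K : ℝ≥0, ∃ A ∈ 𝓝 x₀, ∀ b ∈ S,
    LipschitzOnWith K (fun x => f x b) A) ⟨0, univ, univ_mem, by simp⟩ ?_ ?_ ?_
  · rintro S S' hSS' ⟨K, A, hA, h⟩
    exact ⟨K, A, hA, fun b hb => h b (hSS' hb)⟩
  · rintro S S' ⟨K, A, hA, h⟩ ⟨K', A', hA', h'⟩
    refine ⟨max K K', A ∩ A', inter_mem hA hA', fun b hb => ?_⟩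
    rcases hb with hb | hb
    · exact ((h b hb).weaken (le_max_left _ _)).mono inter_subset_left
    · exact ((h' b hb).weaken (le_max_right _ _)).mono inter_subset_right
  · intro b _
    obtain ⟨K, A, hA, B, hB, h⟩ := hfL x₀ b
    exact ⟨B, mem_nhdsWithin_of_mem_nhds hB, K, A, hA, h⟩

/-- The velocity of the closed loop at a point `x` with foot `p` and normal `c'` exceeds the
min-max rate in a direction `c` near `c'` by at most a multiple of the distance to the set, up to
terms that vanish as `c` tends to `c'`. -/
theorem inner_velocity_sub_minmaxRate_le (hU : IsCompactConvex U) (hW : IsCompactConvex W)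
    (hf : Continuous (Function.uncurry f)) (hG : Continuous G) {Z : Set (E nx)}
    (hZ : IsCompactConvex Z) {N : Set (E nx)} {C : ℝ} (hC : 0 ≤ C)
    (hfN : ∀ b ∈ W, ∀ y ∈ N, ∀ z ∈ N, ‖f y b - f z b‖ ≤ C * ‖y - z‖)
    (hGN : ∀ y ∈ N, ∀ z ∈ N, ‖G y - G z‖ ≤ C * ‖y - z‖) (hGC : ∀ y ∈ N, ‖G y‖ ≤ C)
    (hUC : ∀ ν ∈ U, ‖ν‖ ≤ C) {x p c c' ξ : E nx} (hx : x ∈ N) (hp : p ∈ N) (hξN : ξ ∈ N)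
    (hc : ‖c‖ = 1) (hξ : ξ ∈ argmaxSet Z c) {b : E nw} (hb : b ∈ W)
    {u v : E nu} (hu : u ∈ U) (hv : v ∈ U) (hmin : ∀ ν ∈ U, ⟪c', G p v⟫_ℝ ≤ ⟪c', G p ν⟫_ℝ)
    (huv : ‖u - v‖ ≤ C * ‖x - p‖) :
    ⟪c, f x b + G x u⟫_ℝ - minmaxRate f G U W c Z ≤
      (C + 2 * C ^ 2) * (‖x - p‖ + ‖p - ξ‖ + ‖c - c'‖) := by
  -- `ν` is optimal for `(c, ξ)`, whereas `v` is optimal for `(c', p)`. The bounds `e1` to `e8` pass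
  -- from `(x, u)` to `(p, v)`, change `c` to `c'`, replace `v` by `ν`, and return to `c` and `ξ`.
  -- Errors in `x - p` cost `C + 2C²`, in `p - ξ` they cost `C + C²`, and in `c - c'` they cost
  -- `2C²`.
  obtain ⟨ν, hν, hνmin⟩ := hU.compact.exists_isMinOn hU.nonempty
    (f := fun ν => ⟪c, G ξ ν⟫_ℝ) (by fun_prop)
  have hrate := le_minmaxRate hU hW hf hG hZ hξ hb fun ν' hν' => hνmin hν'
  have hin : ∀ (d y : E nx), ⟪d, y⟫_ℝ ≤ ‖d‖ * ‖y‖ := real_inner_le_norm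
  have hcy : ∀ y : E nx, ⟪c, y⟫_ℝ ≤ ‖y‖ := fun y => by simpa [hc] using hin c y
  have e1 := (hcy (f x b - f p b)).trans (hfN b hb x hx p hp)
  have e2 := (hcy (f p b - f ξ b)).trans (hfN b hb p hp ξ hξN)
  have e3 : ⟪c, (G x - G p) u⟫_ℝ ≤ C * ‖x - p‖ * C := (hcy _).trans
    (((G x - G p).le_opNorm u).trans
      (mul_le_mul (hGN x hx p hp) (hUC u hu) (norm_nonneg _) (by positivity)))
  have e4 : ⟪c, G p (u - v)⟫_ℝ ≤ C * (C * ‖x - p‖) := (hcy _).trans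
    (((G p).le_opNorm _).trans (mul_le_mul (hGC p hp) huv (norm_nonneg _) hC))
  have e5 : ⟪c - c', G p v⟫_ℝ ≤ ‖c - c'‖ * (C * C) := (hin _ _).trans
    (mul_le_mul_of_nonneg_left (((G p).le_opNorm _).trans
      (mul_le_mul (hGC p hp) (hUC v hv) (norm_nonneg _) hC)) (norm_nonneg _))
  have e6 : ⟪c' - c, G p ν⟫_ℝ ≤ ‖c - c'‖ * (C * C) := by
    rw [norm_sub_rev]
    exact (hin _ _).trans
      (mul_le_mul_of_nonneg_left (((G p).le_opNorm _).trans
        (mul_le_mul (hGC p hp) (hUC ν hν) (norm_nonneg _) hC)) (norm_nonneg _))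
  have e7 : ⟪c, (G p - G ξ) ν⟫_ℝ ≤ C * ‖p - ξ‖ * C := (hcy _).trans
    (((G p - G ξ).le_opNorm ν).trans
      (mul_le_mul (hGN p hp ξ hξN) (hUC ν hν) (norm_nonneg _) (by positivity)))
  have e8 := hmin ν hν
  simp only [inner_add_right, inner_sub_right, inner_sub_left, sub_apply,
    map_sub] at hrate e1 e2 e3 e4 e5 e6 e7 ⊢
  have h1 : 0 ≤ C * ‖c - c'‖ := by positivity
  have h2 : 0 ≤ C ^ 2 * ‖p - ξ‖ := by positivity
  nlinarith

end Tube

/-! ### Invariance of the tube -/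

section Invariance

variable {nx nu nw : ℕ} {f : E nx → E nw → E nx} {G : E nx → E nu →L[ℝ] E nx}
  {U : Set (E nu)} {W : Set (E nw)} {t₁ t₂ : ℝ} {Y : ℝ → Set (E nx)}

/-- Growth of the signed distance of a trajectory to a fixed supporting half-space of a tube. -/
theorem SatisfiesMinmaxDI.inner_sub_support_le (hY : SatisfiesMinmaxDI f G U W t₁ t₂ Y)
    {τ t : ℝ} (h1 : t₁ ≤ τ) (hτ : τ ≤ t) (h2 : t ≤ t₂) {x : ℝ → E nx}
    (hx : AbsolutelyContinuousOnInterval x τ t) (c : E nx) {M : ℝ}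
    (hM : ∀ᵐ σ ∂(volume.restrict (Icc τ t)), ∃ v, HasDerivAt x v σ ∧
      ⟪c, v⟫_ℝ - minmaxRate f G U W c (Y σ) ≤ M) :
    (⟪c, x t⟫_ℝ - support (Y t) c) - (⟪c, x τ⟫_ℝ - support (Y τ) c) ≤ M * (t - τ) := by
  have hsub : Icc τ t ⊆ Icc t₁ t₂ := Icc_subset_Icc h1 h2
  obtain ⟨K, hK⟩ := hY.lipschitz c
  have hV : AbsolutelyContinuousOnInterval (fun σ => support (Y σ) c) τ t :=
    LipschitzOnWith.absolutelyContinuousOnInterval (hK.mono (by rwa [uIcc_of_le hτ]))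
  have hcx : AbsolutelyContinuousOnInterval (fun σ => ⟪c, x σ⟫_ℝ) τ t :=
    hx.lipschitz_comp (innerSL ℝ c).lipschitz
  refine (hcx.sub hV).sub_le_of_deriv_le hτ ?_
  have hineq := ae_restrict_of_ae_restrict_of_subset hsub (hY.inequality c)
  have hdiff := hV.ae_differentiableAt
  rw [uIcc_of_le hτ, ← ae_restrict_iff' measurableSet_Icc] at hdiff
  filter_upwards [hM, hineq, hdiff] with σ ⟨v, hv, hvM⟩ hσ hd
  have h3 : HasDerivAt (fun σ => ⟪c, x σ⟫_ℝ) ⟪c, v⟫_ℝ σ := by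
    simpa using (hasDerivAt_const σ c).inner ℝ hv
  rw [(h3.sub hd.hasDerivAt).deriv]
  linarith

/-- An explicit feedback is minimizing at the boundary points of the tube. -/
theorem FollowsExplicitLaw.isMin {μ : ℝ → E nx → E nu}
    (hμ : FollowsExplicitLaw G U t₁ t₂ Y μ) {t : ℝ} (ht : t ∈ Icc t₁ t₂)
    (hcc : IsCompactConvex (Y t)) (hsm : IsSmoothPositivelyCurved (Y t)) {ξ p c : E nx}
    (h : IsFoot (Y t) ξ p c) {ν : E nu} (hν : ν ∈ U) :
    ⟪c, G p (μ t p)⟫_ℝ ≤ ⟪c, G p ν⟫_ℝ := by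
  obtain ⟨μs, h1, h2⟩ := hμ
  have h3 := (h1 t ht c (by simpa using h.norm_eq)).2 ν hν
  rwa [← eq_invGaussMap hcc hsm h.norm_eq h.mem_argmaxSet, h.normal_eq hsm.1,
    ← h2 t ht p h.mem_frontier, ← h.normal_eq hsm.1] at h3

theorem IsFoot.dist_eq_infDist {n : ℕ} {Z : Set (E n)} {ξ p c : E n} (h : IsFoot Z ξ p c)
    (hcc : IsCompactConvex Z) : dist ξ p = Metric.infDist ξ Z := by
  rw [Metric.infDist_eq_iInf, dist_eq_norm]
  simp only [dist_eq_norm]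
  exact (norm_eq_iInf_iff_real_inner_le_zero hcc.convex h.mem_argmaxSet.1).2
    fun q hq => h.inner_sub_nonpos hq

/-- A nonnegative continuous function that starts at zero, and whose right slopes are at most `Λ`
times its maximum, vanishes at the end of an interval shorter than `1 / Λ`. -/
theorem eq_zero_of_slope_le {d : ℝ → ℝ} {a b Λ : ℝ} (hab : a ≤ b) (hd : ContinuousOn d (Icc a b))
    (hd0 : ∀ t ∈ Icc a b, 0 ≤ d t) (hda : d a = 0) (hΛ : Λ * (b - a) < 1)
    (hΛ0 : 0 ≤ Λ) (hslope : ∀ m, (∀ t ∈ Icc a b, d t ≤ m) → ∀ t ∈ Ico a b, ∀ r, Λ * m < r →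
      ∃ᶠ z in 𝓝[>] t, slope d t z < r) : d b = 0 := by
  obtain ⟨t, ht, hm⟩ := isCompact_Icc.exists_isMaxOn (nonempty_Icc.2 hab) hd
  -- The barrier is the line through zero at `a` with slope `Λ max d`; at a maximum point it gives
  -- `max d ≤ Λ (b - a) max d`.
  have h1 := image_le_of_liminf_slope_right_le_deriv_boundary hd
    (B := fun s => Λ * d t * (s - a)) (B' := fun _ => Λ * d t) (by simp [hda]) (by fun_prop)
    (fun s _ => by
      simpa using (((hasDerivAt_id s).sub_const a).const_mul (Λ * d t)).hasDerivWithinAt)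
    (hslope (d t) fun s hs => hm hs) ht
  have h2 : d b ≤ d t := hm (right_mem_Icc.2 hab)
  have h3 := hd0 t ht
  have h4 := hd0 b (right_mem_Icc.2 hab)
  have h5 : Λ * (t - a) ≤ Λ * (b - a) := mul_le_mul_of_nonneg_left (by linarith [ht.2]) hΛ0
  nlinarith

/-- A tube can be continued (constantly) in time. -/
theorem SatisfiesMinmaxDI.exists_extension (hY : SatisfiesMinmaxDI f G U W t₁ t₂ Y)
    (hYsm : ∀ t ∈ Icc t₁ t₂, IsSmoothPositivelyCurved (Y t)) (h : t₁ ≤ t₂) :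
    ∃ (Y' : ℝ → Set (E nx)) (R : ℝ), (∀ t ∈ Icc t₁ t₂, Y' t = Y t) ∧
      (∀ t, IsCompactConvex (Y' t)) ∧ (∀ t, IsSmoothPositivelyCurved (Y' t)) ∧
      (Continuous fun q : ℝ × E nx => support (Y' q.1) q.2) ∧ ∀ t, ∀ z ∈ Y' t, ‖z‖ ≤ R := by
  obtain ⟨R, -, hR⟩ := hY.exists_norm_le
  refine ⟨fun t => Y (projIcc t₁ t₂ h t), R, fun t ht => ?_,
    fun t => hY.compactConvex _ (projIcc t₁ t₂ h t).2, fun t => hYsm _ (projIcc t₁ t₂ h t).2,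
    hY.continuous_support h, fun t => hR _ (projIcc t₁ t₂ h t).2⟩
  simp only [projIcc_of_mem h ht]

theorem keepsInTube (hU : IsCompactConvex U) (hW : IsCompactConvex W)
    (hf : Continuous (Function.uncurry f)) (hfL : LocallyLipschitzInState f)
    (hG : ContDiff ℝ 1 G) (hY : SatisfiesMinmaxDI f G U W t₁ t₂ Y)
    (hYsm : ∀ t ∈ Icc t₁ t₂, IsSmoothPositivelyCurved (Y t)) {μ : ℝ → E nx → E nu}
    (hμU : ∀ t ∈ Icc t₁ t₂, ∀ ξ, μ t ξ ∈ U) (hμ : FollowsExplicitLaw G U t₁ t₂ Y μ)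
    (hμL : LipschitzOutwards t₁ t₂ Y μ) : KeepsInTube f G W t₁ t₂ Y μ := by
  intro s s' hs hss hs' w x hw ⟨hxac, hxd⟩ hxs
  by_contra hcon
  have h12 : t₁ ≤ t₂ := hs.trans (hss.trans hs')
  obtain ⟨L, hL⟩ := hμL
  obtain ⟨Y', R, hYY, hcc, hsm, hV, hR'⟩ := hY.exists_extension hYsm h12
  have hsub : Icc s s' ⊆ Icc t₁ t₂ := Icc_subset_Icc hs hs'
  have hxc : ContinuousOn x (Icc s s') := by simpa [uIcc_of_le hss] using hxac.continuousOn
  have hgraph : ContinuousOn (fun t => (t, x t)) (Icc s s') := continuousOn_id.prodMk hxc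
  -- the last time in the tube
  obtain ⟨a, ⟨has, hxa⟩, hlast⟩ : ∃ a, (a ∈ Icc s s' ∧ x a ∈ Y' a) ∧
      ∀ t ∈ Icc s s', x t ∈ Y' t → t ≤ a := by
    have hcl : IsCompact (Icc s s' ∩ (fun t => (t, x t)) ⁻¹' {q : ℝ × E nx | q.2 ∈ Y' q.1}) :=
      isCompact_Icc.of_isClosed_subset
        (hgraph.preimage_isClosed_of_isClosed isClosed_Icc (isClosed_graph_family hcc hV))
        inter_subset_left
    obtain ⟨a, ha, hmax⟩ := hcl.exists_isGreatest
      ⟨s, left_mem_Icc.2 hss, by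
        change x s ∈ Y' s
        rwa [hYY s (hsub (left_mem_Icc.2 hss))]⟩
    exact ⟨a, ha, fun t ht hxt => hmax ⟨ht, hxt⟩⟩
  have has' : a < s' := lt_of_le_of_ne has.2 fun h => hcon (by
    rw [h] at hxa
    rwa [hYY s' (hsub (right_mem_Icc.2 hss))] at hxa)
  have hasub : Icc a s' ⊆ Icc s s' := Icc_subset_Icc_left has.1
  have hout : ∀ t ∈ Ioc a s', x t ∉ Y' t := fun t ht h =>
    absurd (hlast t (hasub (Ioc_subset_Icc_self ht)) h) (not_le.2 ht.1)
  -- feet and normals along the trajectory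
  have hdom : ∀ t ∈ Icc a s', (t, x t) ∈ footDomain Y' := by
    have hcl := isClosed_footDomain hcc hV hR'
    have h1 : ∀ t ∈ Ioc a s', (t, x t) ∈ footDomain Y' := fun t ht =>
      mem_footDomain.2 (exists_isFoot_of_notMem (hcc t) (hout t ht))
    intro t ht
    rw [← closure_Ioc has'.ne] at ht
    have h2 := (hgraph.mono hasub).mono (by rw [closure_Ioc has'.ne] : closure (Ioc a s') ⊆ _)
    have h3 := h2.image_closure ⟨t, ht, rfl⟩
    exact hcl.closure_subset_iff.2 (image_subset_iff.2 h1) h3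
  obtain ⟨p, c, hfoot, hp, hc⟩ : ∃ p c : ℝ → E nx,
      (∀ t ∈ Icc a s', IsFoot (Y' t) (x t) (p t) (c t)) ∧ ContinuousOn p (Icc a s') ∧
      ContinuousOn c (Icc a s') := by
    have hpc : ContinuousOn (fun t => footPair (Y' t) (x t)) (Icc a s') :=
      (continuousOn_footPair hcc hsm hV hR').comp (hgraph.mono hasub) hdom
    exact ⟨_, _, fun t ht => isFoot_footPair hsm (hdom t ht),
      continuous_fst.comp_continuousOn hpc, continuous_snd.comp_continuousOn hpc⟩
  let d : ℝ → ℝ := fun t => ‖x t - p t‖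
  have hd : ContinuousOn d (Icc a s') := ((hxc.mono hasub).sub hp).norm
  have haa : a ∈ Icc a s' := left_mem_Icc.2 has'.le
  have hpa : p a = x a := by
    have h1 := (hfoot a haa).dist_eq_infDist (hcc a)
    rw [Metric.infDist_zero_of_mem hxa] at h1
    exact (dist_eq_zero.1 h1).symm
  have hda : d a = 0 := by simp [d, hpa]
  -- constants on a neighborhood of the point of exit
  obtain ⟨N, C, hNo, haN, hC, hfN, hGN, hGC, hUC, hLC⟩ : ∃ (N : Set (E nx)) (C : ℝ), IsOpen N ∧
      x a ∈ N ∧ 0 ≤ C ∧ (∀ b ∈ W, ∀ y ∈ N, ∀ z ∈ N, ‖f y b - f z b‖ ≤ C * ‖y - z‖) ∧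
      (∀ y ∈ N, ∀ z ∈ N, ‖G y - G z‖ ≤ C * ‖y - z‖) ∧ (∀ y ∈ N, ‖G y‖ ≤ C) ∧
      (∀ ν ∈ U, ‖ν‖ ≤ C) ∧ L ≤ C := by
    obtain ⟨K, A, hA, hK⟩ := hfL.exists_lipschitzOnWith hW.compact (x a)
    obtain ⟨K', A', hA', hK'⟩ := hG.contDiffAt.exists_lipschitzOnWith (x := x a)
    obtain ⟨Cu, hCu⟩ := hU.compact.isBounded.exists_norm_le
    have hGc : ∀ᶠ y in 𝓝 (x a), ‖G y‖ < ‖G (x a)‖ + 1 :=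
      (hG.continuous.norm.tendsto (x a)).eventually (gt_mem_nhds (lt_add_one _))
    obtain ⟨N, hN, hNo, haN⟩ := mem_nhds_iff.1 (inter_mem (inter_mem hA hA') hGc)
    let C : ℝ := K + K' + (‖G (x a)‖ + 1) + |Cu| + |L|
    have hK0 : (0 : ℝ) ≤ K := K.2
    have hK0' : (0 : ℝ) ≤ K' := K'.2
    have hG0 := norm_nonneg (G (x a))
    have hCu0 := abs_nonneg Cu
    have hL0 := abs_nonneg L
    refine ⟨N, C, hNo, haN, by positivity, fun b hb y hy z hz => ?_, fun y hy z hz => ?_,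
      fun y hy => ?_, fun ν hν => ?_, ?_⟩
    · refine ((hK b hb).norm_sub_le (hN hy).1.1 (hN hz).1.1).trans ?_
      exact mul_le_mul_of_nonneg_right (by simp only [C]; linarith) (norm_nonneg _)
    · refine (hK'.norm_sub_le (hN hy).1.2 (hN hz).1.2).trans ?_
      exact mul_le_mul_of_nonneg_right (by simp only [C]; linarith) (norm_nonneg _)
    · have : ‖G y‖ < ‖G (x a)‖ + 1 := (hN hy).2
      simp only [C]; linarith
    · have := (hCu ν hν).trans (le_abs_self Cu)
      simp only [C]; linarith
    · have := le_abs_self L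
      simp only [C]; linarith
  set Λ : ℝ := C + 2 * C ^ 2 with hΛ
  have hΛ0 : 0 ≤ Λ := by positivity
  have hright : ∀ t ∈ Ico a s', 𝓝[≥] t ≤ 𝓝[Icc a s'] t := fun t ht =>
    nhdsWithin_le_iff.2 (Icc_mem_nhdsGE_of_mem ht)
  -- a short time interval after the exit
  obtain ⟨b, hab, hbs, hbΛ, hbN⟩ : ∃ b, a < b ∧ b ≤ s' ∧ Λ * (b - a) < 1 ∧
      ∀ t ∈ Icc a b, x t ∈ N ∧ p t ∈ N := by
    have e1 : ∀ᶠ t in 𝓝[≥] a, x t ∈ N := hright a ⟨le_rfl, has'⟩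
      ((hxc.mono hasub a haa) (hNo.mem_nhds haN))
    have e2 : ∀ᶠ t in 𝓝[≥] a, p t ∈ N := hright a ⟨le_rfl, has'⟩
      ((hp a haa) (hNo.mem_nhds (by rwa [hpa])))
    have e3 : ∀ᶠ t in 𝓝[≥] a, Λ * (t - a) < 1 := by
      have : Continuous fun t => Λ * (t - a) := by fun_prop
      exact nhdsWithin_le_nhds ((this.tendsto a).eventually (gt_mem_nhds (by simp)))
    have e4 : ∀ᶠ t in 𝓝[≥] a, t ∈ Icc a s' := Icc_mem_nhdsGE has'
    obtain ⟨b, hab, hb⟩ := (mem_nhdsGE_iff_exists_Icc_subset).1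
      ((e1.and e2).and (e3.and e4))
    have hbb := hb (right_mem_Icc.2 (le_of_lt hab))
    exact ⟨b, hab, hbb.2.2.2, hbb.2.1, fun t ht => (hb ht).1⟩
  have hbsub : Icc a b ⊆ Icc a s' := Icc_subset_Icc_right hbs
  -- the velocity estimate along the trajectory
  have hvel : ∀ t ∈ Icc a b, ∀ e : E nx, ‖e‖ = 1 → invGaussMap (Y' t) e ∈ N →
      ⟪e, f (x t) (w t) + G (x t) (μ t (x t))⟫_ℝ - minmaxRate f G U W e (Y t) ≤
        Λ * (d t + ‖p t - invGaussMap (Y' t) e‖ + ‖e - c t‖) := by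
    intro t ht e he heN
    have ht' := hsub (hasub (hbsub ht))
    have hft := hfoot t (hbsub ht)
    rw [← hYY t ht']
    refine inner_velocity_sub_minmaxRate_le hU hW hf hG.continuous (hcc t) hC hfN hGN hGC hUC
      (hbN t ht).1 (hbN t ht).2 heN he (invGaussMap_mem (hcc t) (hsm t) he)
      (hw.2 t (hasub (hbsub ht))) (hμU t ht' _) (hμU t ht' (p t)) (fun ν hν => ?_) ?_
    · have hft' := hft
      rw [hYY t ht'] at hft'
      exact hμ.isMin ht' (hY.compactConvex t ht') (hYsm t ht') hft' hν
    -- At time `a` the point is its own foot; the outward Lipschitz bound covers only the later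
    -- times, when `x t` is outside.
    · rcases eq_or_lt_of_le ht.1 with h | h
      · rw [← h, hpa]; simp
      · have hxt := hout t ⟨h, ht.2.trans hbs⟩
        have hdist := hft.dist_eq_infDist (hcc t)
        have hpt := hft.mem_argmaxSet.1
        rw [hYY t ht'] at hxt hdist hpt
        refine (hL t ht' (x t) hxt (p t) hpt hdist).trans ?_
        rw [dist_eq_norm]
        exact mul_le_mul_of_nonneg_right hLC (norm_nonneg _)
  have hzero : d b = 0 := by
    refine eq_zero_of_slope_le hab.le (hd.mono hbsub) (fun t _ => norm_nonneg _) hda hbΛ hΛ0 ?_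
    intro m hm t₀ ht₀ r hr
    have ht₀' : t₀ ∈ Ico a s' := ⟨ht₀.1, ht₀.2.trans_le hbs⟩
    have hct : Tendsto c (𝓝[≥] t₀) (𝓝 (c t₀)) :=
      (hc t₀ (Ico_subset_Icc_self ht₀')).mono_left (hright t₀ ht₀')
    have hpt : Tendsto p (𝓝[≥] t₀) (𝓝 (p t₀)) :=
      (hp t₀ (Ico_subset_Icc_self ht₀')).mono_left (hright t₀ ht₀')
    have hmem : ∀ᶠ t in 𝓝[≥] t₀, t ∈ Icc t₀ b := Icc_mem_nhdsGE ht₀.2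
    -- Two independent times: the set is taken at `q.1`, the frozen normal at `q.2`. The bounds are
    -- thereby uniform over the whole interval of integration.
    have hinv : Tendsto (fun q : ℝ × ℝ => invGaussMap (Y' q.1) (c q.2)) (𝓝[≥] t₀ ×ˢ 𝓝[≥] t₀)
        (𝓝 (p t₀)) := by
      have hf0 := hfoot t₀ (Ico_subset_Icc_self ht₀')
      refine tendsto_invGaussMap hcc hsm hV hR' (φ := Prod.fst) (ψ := fun q => c q.2)
        (tendsto_fst.mono_right nhdsWithin_le_nhds) (hct.comp tendsto_snd) ?_ hf0.norm_eq
        hf0.mem_argmaxSet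
      filter_upwards [tendsto_snd.eventually hmem] with q hq
      exact (hfoot q.2 (hbsub ⟨ht₀.1.trans hq.1, hq.2⟩)).norm_eq
    -- the error terms are small near `t₀`
    obtain ⟨ε, hε, hεr⟩ : ∃ ε > 0, Λ * (m + ε + ε) < r := by
      refine ⟨(r - Λ * m) / (4 * (Λ + 1)), div_pos (by linarith) (by linarith), ?_⟩
      have h1 : (r - Λ * m) / (4 * (Λ + 1)) * (4 * (Λ + 1)) = r - Λ * m :=
        div_mul_cancel₀ _ (by positivity)
      have h2 : 0 < (r - Λ * m) / (4 * (Λ + 1)) := div_pos (by linarith) (by linarith)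
      nlinarith
    have e1 : ∀ᶠ q in 𝓝[≥] t₀ ×ˢ 𝓝[≥] t₀, ‖p q.1 - invGaussMap (Y' q.1) (c q.2)‖ < ε := by
      have h1 := ((hpt.comp tendsto_fst).sub hinv).norm
      rw [sub_self, norm_zero] at h1
      exact h1.eventually (gt_mem_nhds hε)
    have e2 : ∀ᶠ q in 𝓝[≥] t₀ ×ˢ 𝓝[≥] t₀, ‖c q.2 - c q.1‖ < ε := by
      have h1 := ((hct.comp tendsto_snd).sub (hct.comp tendsto_fst)).norm
        (l := 𝓝[≥] t₀ ×ˢ 𝓝[≥] t₀)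
      rw [sub_self, norm_zero] at h1
      exact h1.eventually (gt_mem_nhds hε)
    have e3 : ∀ᶠ q in 𝓝[≥] t₀ ×ˢ 𝓝[≥] t₀, invGaussMap (Y' q.1) (c q.2) ∈ N :=
      hinv.eventually (hNo.mem_nhds (hbN t₀ (Ico_subset_Icc_self ht₀)).2)
    obtain ⟨S, hS, hSq⟩ := (eventually_prod_self_iff (r := fun σ t =>
      (‖p σ - invGaussMap (Y' σ) (c t)‖ < ε ∧ ‖c t - c σ‖ < ε) ∧ invGaussMap (Y' σ) (c t) ∈ N)).1
      ((e1.and e2).and e3)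
    obtain ⟨t', ht', hS'⟩ := (mem_nhdsGE_iff_exists_Icc_subset).1 (inter_mem hS hmem)
    refine Eventually.frequently ?_
    filter_upwards [Ioc_mem_nhdsGT ht'] with t ht
    have htS : Icc t₀ t ⊆ S ∩ Icc t₀ b := (Icc_subset_Icc_right ht.2).trans hS'
    have htb : t ∈ Icc a b := ⟨ht₀.1.trans ht.1.le, (htS (right_mem_Icc.2 ht.1.le)).2.2⟩
    have ht₀b : t₀ ∈ Icc a b := Ico_subset_Icc_self ht₀
    have htt := hsub (hasub (hbsub htb))
    have ht₀t := hsub (hasub (hbsub ht₀b))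
    have hft := hfoot t (hbsub htb)
    have hft₀ := hfoot t₀ (hbsub ht₀b)
    have hIcc : Icc t₀ t ⊆ Icc a b := Icc_subset_Icc ht₀.1 htb.2
    have hac : AbsolutelyContinuousOnInterval x t₀ t := hxac.mono (by
      rw [uIcc_of_le ht.1.le, uIcc_of_le hss]
      exact hIcc.trans (hbsub.trans hasub))
    -- The frozen direction is the normal at the later time `t`: the signed distance is then exact
    -- at `t` and a lower bound for `d` at `t₀`, as an upper slope estimate requires.
    have hgrow := hY.inner_sub_support_le ht₀t.1 ht.1.le htt.2 hac (c t)
      (M := Λ * (m + ε + ε)) (by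
        filter_upwards [ae_restrict_of_ae_restrict_of_subset (hIcc.trans (hbsub.trans hasub)) hxd,
          ae_restrict_mem measurableSet_Icc] with σ hσ hσm
        refine ⟨_, hσ, ?_⟩
        obtain ⟨⟨h1, h2⟩, h3⟩ := hSq σ (htS hσm).1 t (htS (right_mem_Icc.2 ht.1.le)).1
        refine (hvel σ (hIcc hσm) (c t) hft.norm_eq h3).trans ?_
        refine mul_le_mul_of_nonneg_left ?_ hΛ0
        exact add_le_add (add_le_add (hm σ (hIcc hσm)) h1.le) h2.le)
    have hdt : ⟪c t, x t⟫_ℝ - support (Y t) (c t) = d t := by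
      rw [← hYY t htt, ← ((hcc t).mem_argmaxSet.1 hft.mem_argmaxSet).2, ← inner_sub_right]
      exact hft.inner_sub
    have hdt₀ : ⟪c t, x t₀⟫_ℝ - support (Y t₀) (c t) ≤ d t₀ := by
      have h1 := (hcc t₀).inner_le_support (c t) hft₀.mem_argmaxSet.1
      have h2 := real_inner_le_norm (c t) (x t₀ - p t₀)
      rw [hft.norm_eq, one_mul, inner_sub_right] at h2
      rw [hYY t₀ ht₀t] at h1
      linarith
    rw [slope_def_field, div_lt_iff₀ (sub_pos.2 ht.1)]
    have : Λ * (m + ε + ε) * (t - t₀) < r * (t - t₀) :=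
      mul_lt_mul_of_pos_right hεr (sub_pos.2 ht.1)
    linarith
  have hxb : x b = p b := sub_eq_zero.1 (norm_eq_zero.1 hzero)
  exact hout b ⟨hab, hbs⟩ (hxb ▸ (hfoot b ⟨hab.le, hbs⟩).mem_argmaxSet.1)

end Invariance

end RobustTube

theorem corollary1 {nx nu nw : ℕ}
    (f : RobustTube.E nx → RobustTube.E nw → RobustTube.E nx)
    (G : RobustTube.E nx → RobustTube.E nu →L[ℝ] RobustTube.E nx)
    (U : Set (RobustTube.E nu)) (W : Set (RobustTube.E nw))
    (t₁ t₂ : ℝ) (Y : ℝ → Set (RobustTube.E nx))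
    -- standing assumptions on the control and disturbance sets and on the system
    (hU : RobustTube.IsCompactConvex U) (hUint : (interior U).Nonempty)
    (hW : RobustTube.IsCompactConvex W)
    (hf : Continuous (Function.uncurry f)) (hfL : RobustTube.LocallyLipschitzInState f)
    (hG : ContDiff ℝ 1 G)
    -- the conditions on the tube
    (hY : RobustTube.SatisfiesMinmaxDI f G U W t₁ t₂ Y)
    -- the additional regularity conditions
    (hUsm : RobustTube.IsSmoothPositivelyCurved U)
    (hYsm : ∀ t ∈ Set.Icc t₁ t₂, RobustTube.IsSmoothPositivelyCurved (Y t)) :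
    -- the Gauss maps of the cross-sections are invertible, the inverse being given by the argmax
    (∀ t ∈ Set.Icc t₁ t₂,
      Set.BijOn (RobustTube.gaussMap (Y t)) (frontier (Y t))
        (Metric.sphere (0 : RobustTube.E nx) 1) ∧
      ∀ c ∈ Metric.sphere (0 : RobustTube.E nx) 1,
        RobustTube.argmaxSet (Y t) c = {RobustTube.invGaussMap (Y t) c}) ∧
    -- the minimization has a solution, unique unless its objective vanishes identically
    (∀ t ∈ Set.Icc t₁ t₂, ∀ c ∈ Metric.sphere (0 : RobustTube.E nx) 1,
      (RobustTube.argminSet G U (Y t) c).Nonempty ∧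
      (ContinuousLinearMap.adjoint (G (RobustTube.invGaussMap (Y t) c)) c ≠ 0 →
        (RobustTube.argminSet G U (Y t) c).Subsingleton)) ∧
    -- there are feedback laws given by the formula, and all of them keep trajectories in the tube
    (∃ μ : ℝ → RobustTube.E nx → RobustTube.E nu,
      RobustTube.IsFeedbackLaw U t₁ t₂ μ ∧
      RobustTube.FollowsExplicitLaw G U t₁ t₂ Y μ ∧
      RobustTube.LipschitzOutwards t₁ t₂ Y μ) ∧
    (∀ μ : ℝ → RobustTube.E nx → RobustTube.E nu,
      RobustTube.IsFeedbackLaw U t₁ t₂ μ →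
      RobustTube.FollowsExplicitLaw G U t₁ t₂ Y μ →
      RobustTube.LipschitzOutwards t₁ t₂ Y μ →
      RobustTube.KeepsInTube f G W t₁ t₂ Y μ) := by
  refine ⟨fun t ht => ?_, fun t ht c hc => ?_,
    RobustTube.exists_feedbackLaw hU hG.continuous hY hUsm hYsm, fun μ hμ hμs hμL =>
      RobustTube.keepsInTube hU hW hf hfL hG hY hYsm hμ.mem hμs hμL⟩
  · have hcc := hY.compactConvex t ht
    exact ⟨RobustTube.bijOn_gaussMap hcc (hYsm t ht), fun c hc =>
      RobustTube.argmaxSet_eq_invGaussMap hcc (hYsm t ht) (by simpa using hc)⟩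
  · rw [RobustTube.argminSet_eq]
    exact ⟨hU.argmaxSet_nonempty _, fun h => RobustTube.argmaxSet_subsingleton hU.convex
      hU.compact.isClosed hUsm (neg_ne_zero.2 h)⟩
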